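/- Let $\theta,\alpha\in\mathbb{R}$, let $(\varepsilon_t)_{t\in\mathbb{Z}}$ and $(\eta_t)_{t\in\mathbb{Z}}$ be real random sequences on a probability space, write $\sigma_a=\mathbb{E}[\varepsilon_0^a]$, $\tau_a=\mathbb{E}[\eta_0^a]$, and let $(X_t)_{t\in\mathbb{Z}}$ be a strictly stationary process such that almost surely, for all $t\in\mathbb{Z}$, $$X_t=\theta_t X_{t-1}+\varepsilon_t,\qquad \theta_t=\theta+\alpha\,\eta_{t-1}+\eta_t .$$ Assume: (H$_1$) $(\varepsilon_t)$ and $(\eta_t)$ are each independent and identically distributed, the two sequences are independent of each other, $\mathbb{E}[\ln^+|\varepsilon_0|]<\infty$ and $\mathbb{E}[\ln|\theta+\alpha\eta_0+\eta_1|]<0$ (the value $-\infty$ being allowed); (H$_2$) $\sigma_{2k+1}=0$ and $\tau_{2k+1}=0$ for every $k\in\mathbb{N}$ for which the respective moment exists; (H$_3$) $0<\sigma_2<\infty$, $\tau_2>0$, $\tau_4<\infty$ and $\rho(M)<1$, where $\rho$ is the spectral radius and $$M=\begin{pmatrix}\theta^2+\tau_2&2\alpha\theta&\alpha^2\\2\theta\tau_2&2\alpha\tau_2&0\\\theta^2\tau_2+\tau_4&2\alpha\theta\tau_2&\alpha^2\tau_2\end{pmatrix}.$$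 For $n\ge1$ put $$\widehat\theta_n=\frac{\sum_{t=1}^nX_{t-1}X_t}{\sum_{t=1}^nX_{t-1}^2},\qquad \widehat\sigma_{2,n}=\frac1n\sum_{t=1}^n\big(X_t-\widehat\theta_nX_{t-1}\big)^2 .$$ Then $2\alpha\tau_2\ne1$ and $\mathbb{E}[X_0^2]<\infty$, so that, with $\gamma_X(h)=\mathrm{Cov}(X_h,X_0)$, the quantities $$\theta^*=\frac{\theta}{1-2\alpha\tau_2},\qquad \sigma_2^*=\big(1-(\theta^*)^2\big)\gamma_X(0)$$ are well defined, and $$\widehat\sigma_{2,n}\longrightarrow\sigma_2^*\quad\text{almost surely as } n\to\infty .$$ Moreover $\widehat\sigma_{2,n}$ is not a consistent estimator of $\sigma_2$: it does not converge to $\sigma_2$ in probability (hence not almost surely either). -/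

import Mathlib

open MeasureTheory ProbabilityTheory Filter Topology
open scoped Matrix

namespace RCAR

noncomputable section

/-- A strong white noise indexed by `ℤ`: independent, identically distributed real random
variables. -/
structure IsStrongWhiteNoise {Ω : Type*} [MeasurableSpace Ω] (P : Measure Ω)
    (ξ : ℤ → Ω → ℝ) : Prop where
  measurable : ∀ t, Measurable (ξ t)
  indep : iIndepFun ξ P
  identDistrib : ∀ t, IdentDistrib (ξ t) (ξ 0) P P

/-- The moment `E[ξ₀ ^ a]`. -/
def moment0 {Ω : Type*} [MeasurableSpace Ω] (P : Measure Ω) (ξ : ℤ → Ω → ℝ) (a : ℕ) : ℝ :=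
  ∫ ω, ξ 0 ω ^ a ∂P

/-- The random coefficient `θ_t = θ + α η_{t-1} + η_t`. -/
def coef {Ω : Type*} (θ α : ℝ) (η : ℤ → Ω → ℝ) (t : ℤ) (ω : Ω) : ℝ :=
  θ + α * η (t - 1) ω + η t ω

/-- `E[ln |Y|] < 0`, the expectation being taken in `[-∞, +∞)` with `ln 0 = -∞`: the
expectation of the positive part of `ln |Y|` is (finite and) smaller than the possibly infinite
expectation of its negative part. -/
def ExpLogAbsNeg {Ω : Type*} [MeasurableSpace Ω] (P : Measure Ω) (Y : Ω → ℝ) : Prop :=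
  ∫⁻ ω, (ENNReal.log ‖Y ω‖ₑ).toENNReal ∂P < ∫⁻ ω, (-ENNReal.log ‖Y ω‖ₑ).toENNReal ∂P

/-- First hypothesis: `(ε_t)` and `(η_t)` are mutually independent strong white noises with
`E[ln⁺ |ε₀|] < ∞` and `E[ln |θ + α η₀ + η₁|] < 0`. -/
structure H1 {Ω : Type*} [MeasurableSpace Ω] (P : Measure Ω) (θ α : ℝ)
    (ε η : ℤ → Ω → ℝ) : Prop where
  noise_ε : IsStrongWhiteNoise P ε
  noise_η : IsStrongWhiteNoise P η
  indep : IndepFun (fun ω t => ε t ω) (fun ω t => η t ω) P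
  posLog_ε : Integrable (fun ω => Real.posLog |ε 0 ω|) P
  log_coef : ExpLogAbsNeg P (coef θ α η 1)

/-- Second hypothesis: every odd moment of `ε₀` and of `η₀` that exists is zero. -/
structure H2 {Ω : Type*} [MeasurableSpace Ω] (P : Measure Ω) (ε η : ℤ → Ω → ℝ) : Prop where
  odd_ε : ∀ k : ℕ, Integrable (fun ω => ε 0 ω ^ (2 * k + 1)) P → moment0 P ε (2 * k + 1) = 0
  odd_η : ∀ k : ℕ, Integrable (fun ω => η 0 ω ^ (2 * k + 1)) P → moment0 P η (2 * k + 1) = 0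

/-- The `3 × 3` matrix governing the second-order properties of the process. -/
def matM (θ α τ₂ τ₄ : ℝ) : Matrix (Fin 3) (Fin 3) ℝ :=
  !![θ ^ 2 + τ₂, 2 * α * θ, α ^ 2;
     2 * θ * τ₂, 2 * α * τ₂, 0;
     θ ^ 2 * τ₂ + τ₄, 2 * α * θ * τ₂, α ^ 2 * τ₂]

/-- Third hypothesis: `0 < σ₂ < ∞`, `τ₂ > 0`, `τ₄ < ∞` and `ρ(M) < 1`, where `ρ` is the largest
modulus of a complex eigenvalue. -/
structure H3 {Ω : Type*} [MeasurableSpace Ω] (P : Measure Ω) (θ α : ℝ)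
    (ε η : ℤ → Ω → ℝ) : Prop where
  σ₂_finite : Integrable (fun ω => ε 0 ω ^ 2) P
  τ₄_finite : Integrable (fun ω => η 0 ω ^ 4) P
  σ₂_pos : 0 < moment0 P ε 2
  τ₂_pos : 0 < moment0 P η 2
  spectralRadius_lt :
    spectralRadius ℂ ((matM θ α (moment0 P η 2) (moment0 P η 4)).map (algebraMap ℝ ℂ)) < 1

/-- `(X_t)` is a strictly stationary solution, on `ℤ`, of `X_t = θ_t X_{t-1} + ε_t`:
the law of the whole trajectory is invariant under shifts of time. -/
structure IsStationarySolution {Ω : Type*} [MeasurableSpace Ω] (P : Measure Ω) (θ α : ℝ)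
    (ε η X : ℤ → Ω → ℝ) : Prop where
  measurable : ∀ t, Measurable (X t)
  recurrence : ∀ᵐ ω ∂P, ∀ t : ℤ, X t ω = coef θ α η t ω * X (t - 1) ω + ε t ω
  stationary : ∀ h : ℤ, P.map (fun ω (t : ℤ) => X (t + h) ω) = P.map (fun ω (t : ℤ) => X t ω)

/-- The autocovariance function `γ_X(h) = Cov(X_h, X_0)` of a stationary process. -/
def autocov {Ω : Type*} [MeasurableSpace Ω] (P : Measure Ω) (X : ℤ → Ω → ℝ) (h : ℤ) : ℝ :=
  cov[X h, X 0; P]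

/-- The usual estimator `(∑_{t=1}^n X_{t-1} X_t) / (∑_{t=1}^n X_{t-1}²)` of `θ`. -/
def thetaHat {Ω : Type*} (X : ℤ → Ω → ℝ) (n : ℕ) (ω : Ω) : ℝ :=
  (∑ t ∈ Finset.Icc 1 n, X ((t : ℤ) - 1) ω * X (t : ℤ) ω) /
    (∑ t ∈ Finset.Icc 1 n, X ((t : ℤ) - 1) ω ^ 2)

/-- The residual `X_t - θ̂_n X_{t-1}`. -/
def residual {Ω : Type*} (X : ℤ → Ω → ℝ) (n : ℕ) (t : ℤ) (ω : Ω) : ℝ :=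
  X t ω - thetaHat X n ω * X (t - 1) ω

/-- The usual estimator `(1/n) ∑_{t=1}^n (X_t - θ̂_n X_{t-1})²` of `σ₂`. -/
def sigmaHat {Ω : Type*} (X : ℤ → Ω → ℝ) (n : ℕ) (ω : Ω) : ℝ :=
  (1 / (n : ℝ)) * ∑ t ∈ Finset.Icc 1 n, residual X n (t : ℤ) ω ^ 2

/-- `θ* = θ / (1 - 2 α τ₂)`. -/
def thetaStar (θ α τ₂ : ℝ) : ℝ := θ / (1 - 2 * α * τ₂)

/-- `σ₂* = (1 - (θ*)²) γ_X(0)`. -/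
def sigmaStar {Ω : Type*} [MeasurableSpace Ω] (P : Measure Ω) (θ α : ℝ)
    (η X : ℤ → Ω → ℝ) : ℝ :=
  (1 - thetaStar θ α (moment0 P η 2) ^ 2) * autocov P X 0

end

end RCAR

/-! The limit is the best linear prediction error. With zero mean, `u = E[X₀²]` and `r = E[X₀X₁]`,
the ergodic theorem sends `θ̂ₙ` to `r/u` and `σ̂₂,ₙ` to `(1 - (r/u)²)u = E[(X₁ - (r/u)X₀)²]`.
Conditioning on the past splits this as `E[((θ - r/u)X₀ + αη₀X₀)²] + τ₂u + σ₂`, which exceeds `σ₂`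
because `τ₂u > 0`. So convergence to `σ₂` fails even along a subsequence.

To identify `r/u`, consider `V = (E[X²], E[ηX²], E[η²X²])`. Odd moments vanish, so one step of the
recursion acts on `V` as `V ↦ MV + σ₂(1, 0, τ₂)` (`IsStep.momentVec_next`). The second row of the
fixed-point equation gives `r/u = θ*`.

Since `ρ(M) < 1`, the homogeneous recursion contracts in `L²`. Hence `X` is the limit of recursions
started from zero in the remote past: it is square integrable, causal, and a fixed measurable
function of the shifted noise (`IsSolution.exists_factor`). The shift of an i.i.d. sequence is
ergodic, so Birkhoff's theorem applies to `X²` and to the lagged products. -/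

namespace MeasureTheory

/-! ### Birkhoff's ergodic theorem. -/

variable {S : Type*} [MeasurableSpace S] {μ : Measure S} {T : S → S} {f : S → ℝ}

/-- The maximum of the Birkhoff sums of length at most `n`. -/
noncomputable def birkhoffMax (T : S → S) (f : S → ℝ) : ℕ → S → ℝ
  | 0, _ => 0
  | n + 1, x => max 0 (f x + birkhoffMax T f n (T x))

omit [MeasurableSpace S] in
theorem birkhoffMax_nonneg (n : ℕ) (x : S) : 0 ≤ birkhoffMax T f n x := by
  cases n with
  | zero => exact le_rfl
  | succ n => exact le_max_left _ _

omit [MeasurableSpace S] in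
theorem birkhoffMax_le_succ (n : ℕ) : ∀ x : S, birkhoffMax T f n x ≤ birkhoffMax T f (n + 1) x := by
  induction n with
  | zero => exact fun x => birkhoffMax_nonneg 1 x
  | succ n ih =>
    intro x
    have := ih (T x)
    simp only [birkhoffMax] at this ⊢
    gcongr

omit [MeasurableSpace S] in
theorem birkhoffSum_le_birkhoffMax (n : ℕ) : ∀ x : S, birkhoffSum T f n x ≤ birkhoffMax T f n x := by
  induction n with
  | zero => simp [birkhoffMax]
  | succ n ih =>
    intro x
    rw [birkhoffSum_succ']
    exact (add_le_add le_rfl (ih (T x))).trans (le_max_right _ _)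

theorem measurable_birkhoffMax (hT : Measurable T) (hf : Measurable f) (n : ℕ) :
    Measurable (birkhoffMax T f n) := by
  induction n with
  | zero => exact measurable_const
  | succ n ih => exact measurable_const.max (hf.add (ih.comp hT))

theorem integrable_birkhoffMax [IsFiniteMeasure μ] (hT : MeasurePreserving T μ μ)
    (hf : Integrable f μ) (n : ℕ) : Integrable (birkhoffMax T f n) μ := by
  induction n with
  | zero => exact integrable_zero _ _ _
  | succ n ih =>
    exact (integrable_zero S ℝ μ).sup (hf.add (hT.integrable_comp_of_integrable ih))

-- The recursion moves a bound from `T x` to `x` and back, so the set where the maxima stay bounded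
-- is exactly invariant and ergodicity applies to it.
omit [MeasurableSpace S] in
theorem bddAbove_birkhoffMax_comp_iff (x : S) :
    (∃ C, ∀ n, birkhoffMax T f n (T x) ≤ C) ↔ ∃ C, ∀ n, birkhoffMax T f n x ≤ C := by
  constructor
  · rintro ⟨C, hC⟩
    refine ⟨max 0 (f x + C), fun n => (birkhoffMax_le_succ n x).trans ?_⟩
    simp only [birkhoffMax]
    gcongr
    exact hC n
  · rintro ⟨C, hC⟩
    refine ⟨C - f x, fun n => ?_⟩
    have := (le_max_right 0 _).trans (hC (n + 1))
    linarith

theorem _root_.Ergodic.ae_bddAbove_birkhoffMax [IsProbabilityMeasure μ] (hT : Ergodic T μ)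
    (hfm : Measurable f) (hf : Integrable f μ) (hneg : ∫ x, f x ∂μ < 0) :
    ∀ᵐ x ∂μ, ∃ C, ∀ n, birkhoffMax T f n x ≤ C := by
  have hmeas : MeasurableSet {x | ∃ C, ∀ n, birkhoffMax T f n x ≤ C} := by
    have : {x | ∃ C, ∀ n, birkhoffMax T f n x ≤ C} =
        {x | BddAbove (Set.range fun n => birkhoffMax T f n x)} := by
      ext x
      simp [bddAbove_def]
    rw [this]
    exact measurableSet_bddAbove_range fun n => measurable_birkhoffMax hT.measurable hfm n
  have hinv : T ⁻¹' {x | ∃ C, ∀ n, birkhoffMax T f n x ≤ C} =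
      {x | ∃ C, ∀ n, birkhoffMax T f n x ≤ C} :=
    Set.ext fun x => bddAbove_birkhoffMax_comp_iff x
  rcases hT.toPreErgodic.ae_mem_or_ae_notMem hmeas hinv with h | h
  · exact h
  exfalso
  -- If the maxima are a.e. unbounded, they increase at `T x` past `-f x`; from then on the outer
  -- `max` is inactive and the difference equals `f x`.
  have hlim : Tendsto (fun n => ∫ x, (birkhoffMax T f (n + 1) x - birkhoffMax T f n (T x)) ∂μ)
      atTop (𝓝 (∫ x, f x ∂μ)) := by
    refine tendsto_integral_of_dominated_convergence (fun x => |f x|) (fun n => ?_) hf.abs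
      (fun n => ?_) ?_
    · exact ((measurable_birkhoffMax hT.measurable hfm _).sub
        ((measurable_birkhoffMax hT.measurable hfm _).comp hT.measurable)).aestronglyMeasurable
    · refine .of_forall fun x => ?_
      have h0 := birkhoffMax_nonneg (T := T) (f := f) n (T x)
      simp only [birkhoffMax, Real.norm_eq_abs]
      rcases max_cases 0 (f x + birkhoffMax T f n (T x)) with ⟨h1, h2⟩ | ⟨h1, h2⟩ <;> rw [h1]
      · rw [abs_le]
        constructor <;> linarith [neg_abs_le (f x), abs_nonneg (f x)]
      · simp
    · filter_upwards [h] with x hx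
      have hx' : ¬ ∃ C, ∀ n, birkhoffMax T f n (T x) ≤ C :=
        fun h' => hx ((bddAbove_birkhoffMax_comp_iff x).1 h')
      push Not at hx'
      obtain ⟨N, hN⟩ := hx' (-f x)
      refine tendsto_const_nhds.congr' ?_
      filter_upwards [eventually_ge_atTop N] with n hn
      have h1 : birkhoffMax T f N (T x) ≤ birkhoffMax T f n (T x) :=
        monotone_nat_of_le_succ (f := fun n => birkhoffMax T f n (T x))
          (fun n => birkhoffMax_le_succ n _) hn
      simp only [birkhoffMax]
      rw [max_eq_right (by linarith)]
      ring
  -- By invariance of `μ` each integral equals that of `birkhoffMax (n + 1) - birkhoffMax n`, which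
  -- is nonnegative.
  refine absurd hneg (not_lt.2 (ge_of_tendsto' hlim fun n => ?_))
  have hi := integrable_birkhoffMax hT.toMeasurePreserving hf
  have hiT : Integrable (fun x => birkhoffMax T f n (T x)) μ :=
    hT.toMeasurePreserving.integrable_comp_of_integrable (hi n)
  rw [integral_sub (hi _) hiT]
  have : ∫ x, birkhoffMax T f n (T x) ∂μ = ∫ x, birkhoffMax T f n x ∂μ := by
    rw [← integral_map hT.measurable.aemeasurable
      (measurable_birkhoffMax hT.measurable hfm n).aestronglyMeasurable,
      hT.toMeasurePreserving.map_eq]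
  rw [this, sub_nonneg]
  exact integral_mono (hi _) (hi _) (birkhoffMax_le_succ n)

/-- Half of `δ` makes the centred function have negative mean, so its sums are bounded by some `C`;
the other half absorbs `C` for large `n`. -/
theorem _root_.Ergodic.ae_eventually_birkhoffSum_le [IsProbabilityMeasure μ] (hT : Ergodic T μ)
    (hfm : Measurable f) (hf : Integrable f μ) {δ : ℝ} (hδ : 0 < δ) :
    ∀ᵐ x ∂μ, ∀ᶠ n : ℕ in atTop, birkhoffSum T f n x ≤ n * (∫ y, f y ∂μ + δ) := by
  set c := ∫ y, f y ∂μ + δ / 2 with hc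
  have hg : Integrable (fun x => f x - c) μ := hf.sub (integrable_const c)
  have hneg : ∫ x, (f x - c) ∂μ < 0 := by
    rw [integral_sub hf (integrable_const c)]
    simp only [integral_const, probReal_univ, smul_eq_mul, one_mul]
    linarith
  filter_upwards [hT.ae_bddAbove_birkhoffMax (hfm.sub_const c) hg hneg] with x ⟨C, hC⟩
  obtain ⟨N, hN⟩ := exists_nat_ge (C / (δ / 2))
  filter_upwards [eventually_ge_atTop N] with n hn
  have h1 := (birkhoffSum_le_birkhoffMax (T := T) (f := fun x => f x - c) n x).trans (hC n)
  have h2 : birkhoffSum T (fun x => f x - c) n x = birkhoffSum T f n x - n * c := by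
    simp [birkhoffSum, Finset.sum_sub_distrib]
  have h3 : C ≤ n * (δ / 2) := by
    rw [div_le_iff₀ (by positivity)] at hN
    refine hN.trans ?_
    gcongr
  rw [h2] at h1
  have : (n : ℝ) * (∫ y, f y ∂μ + δ) = n * c + n * (δ / 2) := by rw [hc]; ring
  linarith

/-- **Birkhoff's pointwise ergodic theorem** for an ergodic transformation. -/
theorem _root_.Ergodic.ae_tendsto_birkhoffAverage [IsProbabilityMeasure μ] (hT : Ergodic T μ)
    (hfm : Measurable f) (hf : Integrable f μ) :
    ∀ᵐ x ∂μ, Tendsto (fun n : ℕ => birkhoffAverage ℝ T f n x) atTop (𝓝 (∫ y, f y ∂μ)) := by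
  have hpos : ∀ k : ℕ, (0 : ℝ) < 1 / ((k : ℝ) + 1) := fun k => Nat.one_div_pos_of_nat
  have h1 := ae_all_iff.2 fun k : ℕ => hT.ae_eventually_birkhoffSum_le hfm hf (hpos k)
  have h2 := ae_all_iff.2 fun k : ℕ => hT.ae_eventually_birkhoffSum_le hfm.neg hf.neg (hpos k)
  filter_upwards [h1, h2] with x hx1 hx2
  rw [Metric.tendsto_atTop']
  intro δ hδ
  obtain ⟨k, hk⟩ := exists_nat_one_div_lt hδ
  have := (hx1 k).and ((hx2 k).and (eventually_gt_atTop 0))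
  rw [eventually_atTop] at this
  obtain ⟨N, hN⟩ := this
  refine ⟨N, fun n hn => ?_⟩
  obtain ⟨h3, h4, h5⟩ := hN n hn.le
  have hn0 : (0 : ℝ) < n := Nat.cast_pos.2 h5
  rw [birkhoffSum_neg, integral_neg'] at h4
  rw [Real.dist_eq, birkhoffAverage, smul_eq_mul, inv_mul_eq_div]
  rw [abs_lt]
  constructor
  · rw [lt_sub_iff_add_lt, lt_div_iff₀ hn0]
    nlinarith
  · rw [sub_lt_iff_lt_add, div_lt_iff₀ hn0]
    nlinarith

end MeasureTheory

/-! ### Ergodicity of the i.i.d. shift; independence of pairs. -/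

namespace ProbabilityTheory

variable {E : Type*} [MeasurableSpace E]

/-- The shift of two-sided sequences. -/
def seqShift (h : ℤ) (z : ℤ → E) : ℤ → E := fun t => z (t + h)

omit [MeasurableSpace E] in
theorem seqShift_zero (z : ℤ → E) : seqShift 0 z = z :=
  funext fun t => congrArg z (add_zero t)

theorem measurable_seqShift (h : ℤ) : Measurable (seqShift h : (ℤ → E) → ℤ → E) :=
  measurable_pi_lambda _ fun t => measurable_pi_apply (t + h)

omit [MeasurableSpace E] in
theorem iterate_seqShift (n : ℕ) (z : ℤ → E) : (seqShift 1)^[n] z = seqShift n z := by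
  induction n with
  | zero => funext t; simp [seqShift]
  | succ n ih =>
    rw [Function.iterate_succ_apply', ih]
    funext t
    simp only [seqShift]
    congr 1
    push_cast
    ring

theorem measurePreserving_seqShift (ν : Measure E) [IsProbabilityMeasure ν] (h : ℤ) :
    MeasurePreserving (seqShift h) (Measure.infinitePi fun _ : ℤ => ν)
      (Measure.infinitePi fun _ : ℤ => ν) :=
  ⟨measurable_seqShift h,
    Measure.map_infinitePi_infinitePi_of_inj (P := fun _ : ℤ => ν) (add_left_injective h)⟩

theorem measure_cylinder_inter_preimage_seqShift (ν : Measure E) [IsProbabilityMeasure ν]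
    (I : Finset ℤ) {A : Set (I → E)} (hA : MeasurableSet A) {h : ℤ}
    (hI : ∀ i ∈ I, i + h ∉ I) :
    (Measure.infinitePi fun _ : ℤ => ν) (cylinder I A ∩ seqShift h ⁻¹' cylinder I A) =
      (Measure.infinitePi fun _ : ℤ => ν) (cylinder I A) *
        (Measure.infinitePi fun _ : ℤ => ν) (cylinder I A) := by
  set μ := Measure.infinitePi fun _ : ℤ => ν
  have hind : iIndepFun (fun (i : ℤ) (z : ℤ → E) => z i) μ :=
    iIndepFun_infinitePi (P := fun _ : ℤ => ν) (X := fun _ x => x) fun _ => measurable_id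
  set J : Finset ℤ := I.image (· + h)
  have hdisj : Disjoint I J := by
    rw [Finset.disjoint_left]
    intro j hj hj'
    obtain ⟨i, hi, rfl⟩ := Finset.mem_image.1 hj'
    exact hI i hi hj
  have h1 := hind.indepFun_finset I J hdisj fun i => measurable_pi_apply i
  let g : (J → E) → I → E := fun y i => y ⟨i + h, Finset.mem_image_of_mem _ i.2⟩
  have hg : Measurable g := measurable_pi_lambda _ fun i => measurable_pi_apply _
  have h2 := h1.measure_inter_preimage_eq_mul A (g ⁻¹' A) hA (hg hA)
  have h3 := (measurePreserving_seqShift ν h).measure_preimage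
    (MeasurableSet.cylinder I hA).nullMeasurableSet
  calc _ = _ := h2
    _ = μ (cylinder I A) * μ (seqShift h ⁻¹' cylinder I A) := rfl
    _ = _ := by rw [h3]

/-- The shift of an independent and identically distributed sequence is ergodic. -/
theorem ergodic_seqShift_infinitePi (ν : Measure E) [IsProbabilityMeasure ν] :
    Ergodic (seqShift 1) (Measure.infinitePi fun _ : ℤ => ν) := by
  refine ⟨measurePreserving_seqShift ν 1, ⟨fun s hs hinv => ?_⟩⟩
  set μ := Measure.infinitePi fun _ : ℤ => ν with hμ
  have hinvn : ∀ n : ℕ, seqShift (n : ℤ) ⁻¹' s = s := by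
    intro n
    have : (seqShift (n : ℤ) : (ℤ → E) → ℤ → E) = (seqShift 1)^[n] :=
      funext fun z => (iterate_seqShift n z).symm
    rw [this]
    rw [Set.preimage_iterate_eq]
    exact Function.iterate_fixed hinv n
  -- Mixing argument: a cylinder `B` close to `s` is independent of a far translate of itself, and
  -- that translate is as close to `s`. Hence `μ(s)` is nearly `μ(s)²`.
  have key : ∀ δ : ℝ, 0 < δ → |μ.real s - μ.real s * μ.real s| ≤ 4 * δ := by
    intro δ hδ
    obtain ⟨B, hB, hBs⟩ := exists_measure_symmDiff_lt_of_generateFrom_isSetRing (μ := μ)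
      (isSetRing_measurableCylinders (α := fun _ : ℤ => E))
      ⟨{Set.univ}, Set.countable_singleton _, by
        rw [Set.singleton_subset_iff, mem_measurableCylinders]
        exact ⟨∅, Set.univ, .univ, (cylinder_univ _).symm⟩, by simp⟩
      generateFrom_measurableCylinders.symm hs (ENNReal.ofReal_pos.2 hδ)
    obtain ⟨I, A, hA, rfl⟩ := (mem_measurableCylinders _).1 hB
    obtain ⟨m, hm⟩ := I.finite_toSet.bddAbove
    obtain ⟨l, hl⟩ := I.finite_toSet.bddBelow
    -- A shift longer than the spread of `I` makes `I` and `I + h` disjoint.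
    set h : ℤ := (((m - l).toNat + 1 : ℕ) : ℤ) with hh
    have hI : ∀ i ∈ I, i + h ∉ I := by
      intro i hi hi'
      have h1 := hm hi'
      have h2 := hl hi
      push_cast at hh
      have := Int.self_le_toNat (m - l)
      lia
    have hind := measure_cylinder_inter_preimage_seqShift ν I hA hI
    rw [← hμ] at hind
    set B : Set (ℤ → E) := cylinder I A with hBdef
    have hBm : MeasurableSet B := .cylinder I hA
    have hd : μ.real (symmDiff B s) ≤ δ := by
      refine ENNReal.toReal_le_of_le_ofReal hδ.le hBs.le
    have hd' : μ.real (symmDiff (seqShift h ⁻¹' B) s) ≤ δ := by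
      have h1 : symmDiff (seqShift h ⁻¹' B) s = seqShift h ⁻¹' symmDiff B s := by
        conv_lhs => rw [← hinvn ((m - l).toNat + 1)]
        rfl
      rw [h1, measureReal_def, (measurePreserving_seqShift ν h).measure_preimage
        (hBm.symmDiff hs).nullMeasurableSet]
      exact hd
    have h1 : |μ.real B - μ.real s| ≤ δ :=
      (abs_measureReal_sub_le_measureReal_symmDiff hBm.nullMeasurableSet hs.nullMeasurableSet).trans hd
    have h2 : |μ.real (B ∩ seqShift h ⁻¹' B) - μ.real s| ≤ 2 * δ := by
      refine (abs_measureReal_sub_le_measureReal_symmDiff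
        (hBm.inter (measurable_seqShift h hBm)).nullMeasurableSet hs.nullMeasurableSet).trans ?_
      have hsub : symmDiff (B ∩ seqShift h ⁻¹' B) s ⊆
          symmDiff B s ∪ symmDiff (seqShift h ⁻¹' B) s := by
        intro x
        simp only [Set.mem_symmDiff, Set.mem_inter_iff, Set.mem_union]
        tauto
      calc _ ≤ _ := measureReal_mono hsub
        _ ≤ _ := measureReal_union_le _ _
        _ ≤ 2 * δ := by linarith
    have h3 : μ.real (B ∩ seqShift h ⁻¹' B) = μ.real B * μ.real B := by
      simp only [measureReal_def, hind, ENNReal.toReal_mul]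
    rw [h3] at h2
    have h4 : μ.real B ≤ 1 := measureReal_le_one
    have h5 : μ.real s ≤ 1 := measureReal_le_one
    have h6 : (0 : ℝ) ≤ μ.real B := measureReal_nonneg
    have h7 : (0 : ℝ) ≤ μ.real s := measureReal_nonneg
    rw [abs_le] at h1 h2 ⊢
    constructor <;> nlinarith
  have hzero : μ.real s - μ.real s * μ.real s = 0 := by
    by_contra hne
    have h1 := key (|μ.real s - μ.real s * μ.real s| / 8) (by positivity)
    have h2 := abs_pos.2 hne
    linarith
  rw [eventuallyConst_set']
  have : μ.real s * (1 - μ.real s) = 0 := by linarith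
  rcases mul_eq_zero.1 this with h | h
  · left
    exact ae_eq_empty.2 ((measureReal_eq_zero_iff).1 h)
  · right
    rw [ae_eq_univ, ← measureReal_eq_zero_iff, probReal_compl_eq_one_sub hs, h]

/-- Preimages of rectangles form a generating π-system; on them the probability factors first
between the two families, then over the indices. -/
theorem iIndepFun.prodMk_of_indepFun {Ω ι E F : Type*} [MeasurableSpace Ω] [MeasurableSpace E]
    [MeasurableSpace F] {P : Measure Ω} {f : ι → Ω → E} {g : ι → Ω → F}
    (hfm : ∀ i, Measurable (f i)) (hgm : ∀ i, Measurable (g i))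
    (hf : iIndepFun f P) (hg : iIndepFun g P)
    (hfg : IndepFun (fun ω i => f i ω) (fun ω i => g i ω) P) :
    iIndepFun (fun i ω => (f i ω, g i ω)) P := by
  have := hf.isProbabilityMeasure
  let π : ι → Set (Set Ω) := fun i =>
    {s | ∃ A B, MeasurableSet A ∧ MeasurableSet B ∧ s = f i ⁻¹' A ∩ g i ⁻¹' B}
  rw [iIndepFun_iff_iIndep]
  refine iIndepSets.iIndep (fun i => ((hfm i).prodMk (hgm i)).comap_le) π (fun i => ?_)
    (fun i => ?_) ?_
  · rintro _ ⟨A, B, hA, hB, rfl⟩ _ ⟨A', B', hA', hB', rfl⟩ -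
    exact ⟨A ∩ A', B ∩ B', hA.inter hA', hB.inter hB', by
      rw [Set.preimage_inter, Set.preimage_inter, Set.inter_inter_inter_comm]⟩
  · rw [← generateFrom_prod, MeasurableSpace.comap_generateFrom]
    congr 1
    ext s
    constructor
    · rintro ⟨_, ⟨A, hA, B, hB, rfl⟩, rfl⟩
      exact ⟨A, B, hA, hB, rfl⟩
    · rintro ⟨A, B, hA, hB, rfl⟩
      exact ⟨_, ⟨A, hA, B, hB, rfl⟩, rfl⟩
  · rw [iIndepSets_iff]
    intro S s hs
    choose! A B hA hB hAB using hs
    have h1 : (⋂ i ∈ S, s i) = ((fun ω i => f i ω) ⁻¹' (S : Set ι).pi A) ∩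
        ((fun ω i => g i ω) ⁻¹' (S : Set ι).pi B) := by
      ext ω
      simp only [Set.mem_iInter, Set.mem_inter_iff, Set.mem_preimage, Set.mem_pi,
        Finset.mem_coe, ← forall_and]
      refine forall₂_congr fun i hi => ?_
      rw [hAB i hi]
      rfl
    rw [h1, hfg.measure_inter_preimage_eq_mul _ _ (.pi S.countable_toSet hA)
      (.pi S.countable_toSet hB)]
    have h2 : (fun ω i => f i ω) ⁻¹' (S : Set ι).pi A = ⋂ i ∈ S, f i ⁻¹' A i := by
      ext ω; simp [Set.mem_pi]
    have h3 : (fun ω i => g i ω) ⁻¹' (S : Set ι).pi B = ⋂ i ∈ S, g i ⁻¹' B i := by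
      ext ω; simp [Set.mem_pi]
    rw [h2, h3, hf.measure_inter_preimage_eq_mul S hA, hg.measure_inter_preimage_eq_mul S hB,
      ← Finset.prod_mul_distrib]
    refine Finset.prod_congr rfl fun i hi => ?_
    rw [hAB i hi]
    exact ((hfg.comp (measurable_pi_apply i) (measurable_pi_apply i)).measure_inter_preimage_eq_mul
      _ _ (hA i hi) (hB i hi)).symm

end ProbabilityTheory

/-! ### Powers of a matrix of spectral radius less than one. -/

section
attribute [local instance] Matrix.linftyOpNormedRing Matrix.linftyOpNormedAlgebra
  Matrix.linftyOpNormedAddCommGroup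

/-- Gelfand's formula: for `ρ(a) < r < 1`, eventually `‖a ^ n‖ ≤ r ^ n`. -/
theorem summable_norm_pow_of_spectralRadius_lt_one {A : Type*} [NormedRing A] [NormedAlgebra ℂ A]
    [CompleteSpace A] {a : A} (h : spectralRadius ℂ a < 1) : Summable fun n => ‖a ^ n‖ := by
  obtain ⟨r, hr1, hr2⟩ := ENNReal.lt_iff_exists_nnreal_btwn.1 h
  have hr : (r : ℝ) < 1 := by exact_mod_cast hr2
  have hev := (spectrum.pow_nnnorm_pow_one_div_tendsto_nhds_spectralRadius a).eventually
    (gt_mem_nhds hr1)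
  refine Summable.of_norm_bounded_eventually_nat (g := fun n => (r : ℝ) ^ n)
    (summable_geometric_of_lt_one r.coe_nonneg hr) ?_
  filter_upwards [hev, eventually_gt_atTop 0] with n hn hn0
  have hn0' : (0 : ℝ) < n := Nat.cast_pos.2 hn0
  have h1 : ((‖a ^ n‖₊ : ENNReal) ^ (1 / n : ℝ)) ^ (n : ℝ) ≤ (r : ENNReal) ^ (n : ℝ) :=
    ENNReal.rpow_le_rpow hn.le hn0'.le
  rw [← ENNReal.rpow_mul, one_div_mul_cancel hn0'.ne', ENNReal.rpow_one, ENNReal.rpow_natCast] at h1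
  have h2 : ‖a ^ n‖₊ ≤ r ^ n := by exact_mod_cast h1
  rw [norm_norm]
  exact_mod_cast h2

theorem Matrix.summable_norm_pow_mulVec {m : Type*} [Fintype m] [DecidableEq m]
    {M : Matrix m m ℝ} (h : spectralRadius ℂ (M.map (algebraMap ℝ ℂ)) < 1) (v : m → ℝ) :
    Summable fun n : ℕ => ‖M ^ n *ᵥ v‖ := by
  have h1 := summable_norm_pow_of_spectralRadius_lt_one h
  refine Summable.of_nonneg_of_le (fun n => norm_nonneg _) (fun n => ?_) (h1.mul_right ‖v‖)
  refine (Matrix.linfty_opNorm_mulVec _ _).trans ?_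
  gcongr
  have h2 : (M.map (algebraMap ℝ ℂ)) ^ n = (M ^ n).map (algebraMap ℝ ℂ) :=
    (map_pow (algebraMap ℝ ℂ).mapMatrix M n).symm
  rw [h2]
  simp only [Matrix.linfty_opNorm_def]
  simp

end

/-! ### Moments after one step of the recursion. -/

namespace RCAR

variable {Ω : Type*} [MeasurableSpace Ω] {P : Measure Ω}

/-- Independent random variables `e` and `h` with vanishing odd moments, a second moment `s` of
`e`, and second and fourth moments `t₂`, `t₄` of `h`. -/
structure IsNoisePair (P : Measure Ω) (e h : Ω → ℝ) (s t₂ t₄ : ℝ) : Prop where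
  measurable_left : Measurable e
  measurable_right : Measurable h
  indep : IndepFun h e P
  integrable_left : Integrable (fun ω => e ω ^ 2) P
  integrable_right : Integrable (fun ω => h ω ^ 4) P
  left_one : ∫ ω, e ω ^ 1 ∂P = 0
  left_two : ∫ ω, e ω ^ 2 ∂P = s
  right_one : ∫ ω, h ω ^ 1 ∂P = 0
  right_two : ∫ ω, h ω ^ 2 ∂P = t₂
  right_three : ∫ ω, h ω ^ 3 ∂P = 0
  right_four : ∫ ω, h ω ^ 4 ∂P = t₄

theorem integrable_pow_of_le [IsFiniteMeasure P] {f : Ω → ℝ} (hf : Measurable f) {m n : ℕ}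
    (hmn : m ≤ n) (h : Integrable (fun ω => f ω ^ n) P) : Integrable (fun ω => f ω ^ m) P := by
  refine ((integrable_const (1 : ℝ)).add h.abs).mono' (hf.pow_const m).aestronglyMeasurable
    (.of_forall fun ω => ?_)
  simp only [Real.norm_eq_abs, Pi.add_apply, abs_pow]
  rcases le_total |f ω| 1 with h1 | h1
  · have := pow_le_one₀ (n := m) (abs_nonneg _) h1
    have := pow_nonneg (abs_nonneg (f ω)) n
    linarith
  · have := pow_le_pow_right₀ h1 hmn
    linarith

/-- Integrability and value travel together so that long expansions can be assembled term by term.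
-/
theorem integrable_and_integral_add {f g : Ω → ℝ} {a b : ℝ}
    (hf : Integrable f P ∧ ∫ ω, f ω ∂P = a) (hg : Integrable g P ∧ ∫ ω, g ω ∂P = b) :
    Integrable (fun ω => f ω + g ω) P ∧ ∫ ω, (f ω + g ω) ∂P = a + b :=
  ⟨hf.1.add hg.1, by rw [integral_add hf.1 hg.1, hf.2, hg.2]⟩

theorem integrable_and_integral_const_mul {f : Ω → ℝ} {a : ℝ} (k : ℝ)
    (hf : Integrable f P ∧ ∫ ω, f ω ∂P = a) :
    Integrable (fun ω => k * f ω) P ∧ ∫ ω, k * f ω ∂P = k * a :=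
  ⟨hf.1.const_mul k, by rw [integral_const_mul, hf.2]⟩

namespace IsNoisePair

variable [IsProbabilityMeasure P] {e h W A : Ω → ℝ} {s t₂ t₄ c : ℝ}

theorem integral_monomial_mul (hp : IsNoisePair P e h s t₂ t₄) {R : Ω → ℝ}
    (hR : Integrable R P) (hind : IndepFun R (fun ω => (e ω, h ω)) P) {a b : ℕ}
    (ha : a ≤ 4) (hb : b ≤ 2) :
    Integrable (fun ω => h ω ^ a * e ω ^ b * R ω) P ∧
      ∫ ω, h ω ^ a * e ω ^ b * R ω ∂P =
        (∫ ω, h ω ^ a ∂P) * (∫ ω, e ω ^ b ∂P) * ∫ ω, R ω ∂P := by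
  have hha := integrable_pow_of_le hp.measurable_right ha hp.integrable_right
  have heb := integrable_pow_of_le hp.measurable_left hb hp.integrable_left
  have hi : IndepFun (fun ω => h ω ^ a) (fun ω => e ω ^ b) P :=
    hp.indep.comp (measurable_id.pow_const a) (measurable_id.pow_const b)
  have hi' : IndepFun (fun ω => h ω ^ a * e ω ^ b) R P :=
    (hind.comp measurable_id
      ((measurable_snd.pow_const a).mul (measurable_fst.pow_const b))).symm
  have hmon : Integrable (fun ω => h ω ^ a * e ω ^ b) P := hi.integrable_mul hha heb
  refine ⟨hi'.integrable_mul hmon hR, ?_⟩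
  rw [hi'.integral_fun_mul_eq_mul_integral hmon.1 hR.1,
    hi.integral_fun_mul_eq_mul_integral hha.1 heb.1]

/-- `A` collects the part of the step determined before the new noise. After expanding the square,
independence factors every term, and those linear in `e` vanish. The cases `j = 0, 1, 2` produce the
three rows of `M`; `j = 2` needs the fourth moment of `h`. -/
theorem integral_pow_mul_sq (hp : IsNoisePair P e h s t₂ t₄) (hW : MemLp W 2 P)
    (hA : MemLp A 2 P) (hind : IndepFun (fun ω => (W ω, A ω)) (fun ω => (e ω, h ω)) P) {j : ℕ}
    (hj : j ≤ 2) :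
    Integrable (fun ω => h ω ^ j * (A ω + h ω * W ω + c * e ω) ^ 2) P ∧
      ∫ ω, h ω ^ j * (A ω + h ω * W ω + c * e ω) ^ 2 ∂P =
        (∫ ω, h ω ^ j ∂P) * (∫ ω, A ω ^ 2 ∂P + c ^ 2 * s)
          + (∫ ω, h ω ^ (j + 2) ∂P) * (∫ ω, W ω ^ 2 ∂P)
          + 2 * (∫ ω, h ω ^ (j + 1) ∂P) * ∫ ω, A ω * W ω ∂P := by
  have i1 : IndepFun (fun ω => A ω ^ 2) (fun ω => (e ω, h ω)) P :=
    hind.comp (measurable_snd.pow_const 2) measurable_id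
  have i2 : IndepFun (fun ω => W ω ^ 2) (fun ω => (e ω, h ω)) P :=
    hind.comp (measurable_fst.pow_const 2) measurable_id
  have i3 : IndepFun (fun ω => A ω * W ω) (fun ω => (e ω, h ω)) P :=
    hind.comp (measurable_snd.mul measurable_fst) measurable_id
  have i4 : IndepFun A (fun ω => (e ω, h ω)) P := hind.comp measurable_snd measurable_id
  have i5 : IndepFun W (fun ω => (e ω, h ω)) P := hind.comp measurable_fst measurable_id
  have i6 : IndepFun (fun _ : Ω => (1 : ℝ)) (fun ω => (e ω, h ω)) P :=
    hind.comp (measurable_const (a := (1 : ℝ))) measurable_id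
  have m1 := hp.integral_monomial_mul hA.integrable_sq i1 (a := j) (b := 0) (by lia) (by lia)
  have m2 := hp.integral_monomial_mul hW.integrable_sq i2 (a := j + 2) (b := 0) (by lia)
    (by lia)
  have m3 := hp.integral_monomial_mul (hA.integrable_mul hW) i3 (a := j + 1) (b := 0)
    (by lia) (by lia)
  have m4 := hp.integral_monomial_mul (hA.integrable one_le_two) i4 (a := j) (b := 1)
    (by lia) (by lia)
  have m5 := hp.integral_monomial_mul (hW.integrable one_le_two) i5 (a := j + 1) (b := 1)
    (by lia) (by lia)
  have m6 := hp.integral_monomial_mul (integrable_const 1) i6 (a := j) (b := 2)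
    (by lia) (by lia)
  have hexp : (fun ω => h ω ^ j * (A ω + h ω * W ω + c * e ω) ^ 2) = fun ω =>
      h ω ^ j * e ω ^ 0 * A ω ^ 2 + h ω ^ (j + 2) * e ω ^ 0 * W ω ^ 2
        + 2 * (h ω ^ (j + 1) * e ω ^ 0 * (A ω * W ω)) + 2 * c * (h ω ^ j * e ω ^ 1 * A ω)
        + 2 * c * (h ω ^ (j + 1) * e ω ^ 1 * W ω) + c ^ 2 * (h ω ^ j * e ω ^ 2 * 1) := by
    funext ω
    ring
  have key := integrable_and_integral_add (integrable_and_integral_add (integrable_and_integral_add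
    (integrable_and_integral_add (integrable_and_integral_add m1 m2)
      (integrable_and_integral_const_mul 2 m3)) (integrable_and_integral_const_mul (2 * c) m4))
    (integrable_and_integral_const_mul (2 * c) m5)) (integrable_and_integral_const_mul (c ^ 2) m6)
  rw [hexp]
  refine ⟨key.1, key.2.trans ?_⟩
  rw [hp.left_one, hp.left_two]
  simp only [pow_zero, integral_const, probReal_univ, smul_eq_mul, Pi.mul_apply]
  ring

theorem integral_pow_mul (hp : IsNoisePair P e h s t₂ t₄) (hW : Integrable W P)
    (hA : Integrable A P) (hind : IndepFun (fun ω => (W ω, A ω)) (fun ω => (e ω, h ω)) P) {j : ℕ}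
    (hj : j ≤ 2) :
    ∫ ω, h ω ^ j * (A ω + h ω * W ω + c * e ω) ∂P =
      (∫ ω, h ω ^ j ∂P) * (∫ ω, A ω ∂P) + (∫ ω, h ω ^ (j + 1) ∂P) * (∫ ω, W ω ∂P) := by
  have i4 : IndepFun A (fun ω => (e ω, h ω)) P := hind.comp measurable_snd measurable_id
  have i5 : IndepFun W (fun ω => (e ω, h ω)) P := hind.comp measurable_fst measurable_id
  have i6 : IndepFun (fun _ : Ω => (1 : ℝ)) (fun ω => (e ω, h ω)) P :=
    hind.comp (measurable_const (a := (1 : ℝ))) measurable_id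
  have m1 := hp.integral_monomial_mul hA i4 (a := j) (b := 0) (by lia) (by lia)
  have m2 := hp.integral_monomial_mul hW i5 (a := j + 1) (b := 0) (by lia) (by lia)
  have m3 := hp.integral_monomial_mul (integrable_const 1) i6 (a := j) (b := 1)
    (by lia) (by lia)
  have hexp : (fun ω => h ω ^ j * (A ω + h ω * W ω + c * e ω)) = fun ω =>
      h ω ^ j * e ω ^ 0 * A ω + h ω ^ (j + 1) * e ω ^ 0 * W ω
        + c * (h ω ^ j * e ω ^ 1 * 1) := by
    funext ω
    ring
  have key := integrable_and_integral_add (integrable_and_integral_add m1 m2)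
    (integrable_and_integral_const_mul c m3)
  rw [hexp]
  refine key.2.trans ?_
  rw [hp.left_one]
  simp only [pow_zero, integral_const, probReal_univ, smul_eq_mul]
  ring

theorem integral_mul (hp : IsNoisePair P e h s t₂ t₄) (hW : MemLp W 2 P)
    (hA : MemLp A 2 P) (hind : IndepFun (fun ω => (W ω, A ω)) (fun ω => (e ω, h ω)) P) :
    ∫ ω, W ω * (A ω + h ω * W ω + c * e ω) ∂P = ∫ ω, A ω * W ω ∂P := by
  have i2 : IndepFun (fun ω => W ω ^ 2) (fun ω => (e ω, h ω)) P :=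
    hind.comp (measurable_fst.pow_const 2) measurable_id
  have i5 : IndepFun W (fun ω => (e ω, h ω)) P := hind.comp measurable_fst measurable_id
  have m2 := hp.integral_monomial_mul hW.integrable_sq i2 (a := 1) (b := 0) (by lia)
    (by lia)
  have m3 := hp.integral_monomial_mul (hW.integrable one_le_two) i5 (a := 0) (b := 1)
    (by lia) (by lia)
  have hexp : (fun ω => W ω * (A ω + h ω * W ω + c * e ω)) = fun ω =>
      A ω * W ω + h ω ^ 1 * e ω ^ 0 * W ω ^ 2 + c * (h ω ^ 0 * e ω ^ 1 * W ω) := by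
    funext ω
    ring
  have m1 : Integrable (fun ω => A ω * W ω) P ∧ ∫ ω, A ω * W ω ∂P = ∫ ω, A ω * W ω ∂P :=
    ⟨hA.integrable_mul hW, rfl⟩
  have key := integrable_and_integral_add (integrable_and_integral_add m1 m2)
    (integrable_and_integral_const_mul c m3)
  rw [hexp]
  refine key.2.trans ?_
  rw [hp.left_one, hp.right_one]
  ring

end IsNoisePair

/-- The moments `E[W²]`, `E[g W²]`, `E[g² W²]`. -/
noncomputable def momentVec (P : Measure Ω) (g W : Ω → ℝ) : Fin 3 → ℝ :=
  ![∫ ω, W ω ^ 2 ∂P, ∫ ω, g ω * W ω ^ 2 ∂P, ∫ ω, (g ω * W ω) ^ 2 ∂P]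

theorem integral_affine_mul_sq {g W : Ω → ℝ} (θ α : ℝ) (hW : MemLp W 2 P)
    (hg : MemLp (fun ω => g ω * W ω) 2 P) :
    ∫ ω, (θ * W ω + α * (g ω * W ω)) ^ 2 ∂P =
      θ ^ 2 * momentVec P g W 0 + 2 * α * θ * momentVec P g W 1 + α ^ 2 * momentVec P g W 2 := by
  have h1 := hW.integrable_sq.const_mul (θ ^ 2)
  have h2 : Integrable (fun ω => 2 * α * θ * (g ω * W ω ^ 2)) P := by
    refine Integrable.const_mul ?_ _
    exact (hg.integrable_mul hW).congr (.of_forall fun ω => by simp [pow_two, mul_assoc])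
  have h3 := hg.integrable_sq.const_mul (α ^ 2)
  calc _ = ∫ ω, (θ ^ 2 * W ω ^ 2 + 2 * α * θ * (g ω * W ω ^ 2) + α ^ 2 * (g ω * W ω) ^ 2) ∂P := by
        congr 1
        funext ω
        ring
    _ = _ := by
        rw [integral_add (f := fun ω => _ + _) (h1.add h2) h3, integral_add h1 h2,
          integral_const_mul, integral_const_mul, integral_const_mul]
        rfl

theorem integral_affine_mul_mul {g W : Ω → ℝ} (θ α : ℝ) (hW : MemLp W 2 P)
    (hg : MemLp (fun ω => g ω * W ω) 2 P) :
    ∫ ω, (θ * W ω + α * (g ω * W ω)) * W ω ∂P =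
      θ * momentVec P g W 0 + α * momentVec P g W 1 := by
  have h1 := hW.integrable_sq.const_mul θ
  have h2 : Integrable (fun ω => α * (g ω * W ω ^ 2)) P := by
    refine Integrable.const_mul ?_ _
    exact (hg.integrable_mul hW).congr (.of_forall fun ω => by simp [pow_two, mul_assoc])
  calc _ = ∫ ω, (θ * W ω ^ 2 + α * (g ω * W ω ^ 2)) ∂P := by
        congr 1
        funext ω
        ring
    _ = _ := by
        rw [integral_add h1 h2, integral_const_mul, integral_const_mul]
        rfl

/-- One step `W ↦ (θ + α g + h) W + c e` of the recursion. -/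
structure IsStep (P : Measure Ω) (θ α c : ℝ) (e h g W W' : Ω → ℝ) : Prop where
  memLp : MemLp W 2 P
  memLp_mul : MemLp (fun ω => g ω * W ω) 2 P
  indep : IndepFun (fun ω => (W ω, g ω)) (fun ω => (e ω, h ω)) P
  eq : W' =ᵐ[P] fun ω => (θ + α * g ω + h ω) * W ω + c * e ω

namespace IsStep

variable [IsProbabilityMeasure P] {e h g W W' : Ω → ℝ} {θ α s t₂ t₄ c : ℝ}

omit [IsProbabilityMeasure P] in
theorem memLp_affine (hs : IsStep P θ α c e h g W W') :
    MemLp (fun ω => θ * W ω + α * (g ω * W ω)) 2 P :=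
  (hs.memLp.const_mul θ).add (hs.memLp_mul.const_mul α)

omit [IsProbabilityMeasure P] in
theorem indep_affine (hs : IsStep P θ α c e h g W W') :
    IndepFun (fun ω => (W ω, θ * W ω + α * (g ω * W ω))) (fun ω => (e ω, h ω)) P :=
  hs.indep.comp (φ := fun p : ℝ × ℝ => (p.1, θ * p.1 + α * (p.2 * p.1))) (by fun_prop)
    measurable_id

omit [IsProbabilityMeasure P] in
theorem eq' (hs : IsStep P θ α c e h g W W') :
    W' =ᵐ[P] fun ω => (θ * W ω + α * (g ω * W ω)) + h ω * W ω + c * e ω :=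
  hs.eq.trans (.of_forall fun ω => by ring)

omit [IsProbabilityMeasure P] in
theorem aestronglyMeasurable (hs : IsStep P θ α c e h g W W') (hp : IsNoisePair P e h s t₂ t₄) :
    AEStronglyMeasurable W' P :=
  ((hs.memLp_affine.1.add (hp.measurable_right.aestronglyMeasurable.mul hs.memLp.1)).add
    (hp.measurable_left.aestronglyMeasurable.const_mul c)).congr hs.eq'.symm

theorem memLp_next (hs : IsStep P θ α c e h g W W') (hp : IsNoisePair P e h s t₂ t₄) :
    MemLp W' 2 P ∧ MemLp (fun ω => h ω * W' ω) 2 P := by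
  have hm := hs.aestronglyMeasurable hp
  constructor
  · rw [memLp_two_iff_integrable_sq hm]
    refine (hp.integral_pow_mul_sq (c := c) hs.memLp hs.memLp_affine hs.indep_affine
      (j := 0) (by lia)).1.congr ?_
    filter_upwards [hs.eq'] with ω hω
    rw [hω]
    ring
  · have hm' : AEStronglyMeasurable (fun ω => h ω * W' ω) P :=
      hp.measurable_right.aestronglyMeasurable.mul hm
    rw [memLp_two_iff_integrable_sq hm']
    refine (hp.integral_pow_mul_sq (c := c) hs.memLp hs.memLp_affine hs.indep_affine
      (j := 2) (by lia)).1.congr ?_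
    filter_upwards [hs.eq'] with ω hω
    rw [hω]
    ring

/-- The new noise `h` is the lagged noise of the next step, so it replaces `g` as the weight.
Vanishing first and third moments of `h` close the system on three coordinates. -/
theorem momentVec_next (hs : IsStep P θ α c e h g W W') (hp : IsNoisePair P e h s t₂ t₄) :
    momentVec P h W' = matM θ α t₂ t₄ *ᵥ momentVec P g W + c ^ 2 • ![s, 0, t₂ * s] := by
  have key := fun j hj => (hp.integral_pow_mul_sq (c := c) hs.memLp hs.memLp_affine
    hs.indep_affine (j := j) hj).2
  have h0 := key 0 (by lia)
  have h1 := key 1 (by lia)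
  have h2 := key 2 (by lia)
  have e0 : momentVec P h W' 0 = _ :=
    (integral_congr_ae (by filter_upwards [hs.eq'] with ω hω; rw [hω]; ring)).trans h0
  have e1 : momentVec P h W' 1 = _ :=
    (integral_congr_ae (by filter_upwards [hs.eq'] with ω hω; rw [hω]; ring)).trans h1
  have e2 : momentVec P h W' 2 = _ :=
    (integral_congr_ae (by filter_upwards [hs.eq'] with ω hω; rw [hω]; ring)).trans h2
  have hW : ∫ ω, W ω ^ 2 ∂P = momentVec P g W 0 := rfl
  simp only [integral_affine_mul_sq θ α hs.memLp hs.memLp_mul,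
    integral_affine_mul_mul θ α hs.memLp hs.memLp_mul, hW, Nat.reduceAdd, hp.right_one,
    hp.right_two, hp.right_three, hp.right_four, pow_zero, integral_const, probReal_univ,
    smul_eq_mul] at e0 e1 e2
  funext i
  fin_cases i
  · simp only [Fin.zero_eta, e0, matM, Matrix.mulVec, dotProduct, Fin.sum_univ_three,
      Pi.add_apply, Pi.smul_apply, Matrix.of_apply, Matrix.cons_val, smul_eq_mul]
    ring
  · simp only [Fin.mk_one, e1, matM, Matrix.mulVec, dotProduct, Fin.sum_univ_three,
      Pi.add_apply, Pi.smul_apply, Matrix.of_apply, Matrix.cons_val, smul_eq_mul]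
    ring
  · simp only [Fin.reduceFinMk, e2, matM, Matrix.mulVec, dotProduct, Fin.sum_univ_three,
      Pi.add_apply, Pi.smul_apply, Matrix.of_apply, Matrix.cons_val, smul_eq_mul]
    ring

/-- The two first-order moments also form a closed linear system, homogeneous because `e` is
centred. -/
theorem integral_next (hs : IsStep P θ α c e h g W W') (hp : IsNoisePair P e h s t₂ t₄)
    (hW : ∫ ω, W ω ∂P = 0) (hgW : ∫ ω, g ω * W ω ∂P = 0) :
    ∫ ω, W' ω ∂P = 0 ∧ ∫ ω, h ω * W' ω ∂P = 0 := by
  have hA : ∫ ω, θ * W ω + α * (g ω * W ω) ∂P = 0 := by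
    rw [integral_add ((hs.memLp.integrable one_le_two).const_mul θ)
      ((hs.memLp_mul.integrable one_le_two).const_mul α), integral_const_mul, integral_const_mul,
      hW, hgW]
    ring
  have key := fun j hj => hp.integral_pow_mul (c := c) (hs.memLp.integrable one_le_two)
    (hs.memLp_affine.integrable one_le_two) hs.indep_affine (j := j) hj
  constructor
  · have := key 0 (by lia)
    rw [hA, hW, mul_zero, mul_zero, add_zero] at this
    rw [← this]
    exact integral_congr_ae (by filter_upwards [hs.eq'] with ω hω; rw [hω]; ring)
  · have := key 1 (by lia)
    rw [hA, hW, mul_zero, mul_zero, add_zero] at this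
    rw [← this]
    exact integral_congr_ae (by filter_upwards [hs.eq'] with ω hω; rw [hω]; ring)

theorem integral_mul_next (hs : IsStep P θ α c e h g W W') (hp : IsNoisePair P e h s t₂ t₄) :
    ∫ ω, W ω * W' ω ∂P = θ * momentVec P g W 0 + α * momentVec P g W 1 := by
  rw [← integral_affine_mul_mul θ α hs.memLp hs.memLp_mul,
    ← hp.integral_mul (c := c) hs.memLp hs.memLp_affine hs.indep_affine]
  exact integral_congr_ae (by filter_upwards [hs.eq'] with ω hω; rw [hω])

end IsStep

end RCAR

/-! ### Finite paths of the recursion and their moments. -/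

namespace RCAR

variable {Ω : Type*} [MeasurableSpace Ω] {P : Measure Ω} {ξ : ℤ → Ω → ℝ × ℝ}
  {θ α c x s t₂ t₄ : ℝ}

/-- Independent and identically distributed noise pairs. -/
structure IsNoise (P : Measure Ω) (ξ : ℤ → Ω → ℝ × ℝ) (s t₂ t₄ : ℝ) : Prop where
  pair : ∀ t, IsNoisePair P (fun ω => (ξ t ω).1) (fun ω => (ξ t ω).2) s t₂ t₄
  indep : iIndepFun ξ P
  map_eq : ∀ t, P.map (ξ t) = P.map (ξ 0)

/-- The σ-algebra generated by the noise up to time `t`. -/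
abbrev noisePast (ξ : ℤ → Ω → ℝ × ℝ) (t : ℤ) : MeasurableSpace Ω :=
  ⨆ i ∈ Set.Iic t, MeasurableSpace.comap (ξ i) inferInstance

omit [MeasurableSpace Ω] in
theorem measurable_noisePast {i t : ℤ} (h : i ≤ t) : Measurable[noisePast ξ t] (ξ i) :=
  (comap_measurable (ξ i)).mono
    (le_iSup₂ (f := fun i (_ : i ∈ Set.Iic t) => MeasurableSpace.comap (ξ i) inferInstance) i h)
    le_rfl

omit [MeasurableSpace Ω] in
theorem noisePast_mono {t t' : ℤ} (h : t ≤ t') : noisePast ξ t ≤ noisePast ξ t' :=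
  biSup_mono fun _ hi => le_trans hi h

namespace IsNoise

theorem measurable (hN : IsNoise P ξ s t₂ t₄) (t : ℤ) : Measurable (ξ t) :=
  (hN.pair t).measurable_left.prodMk (hN.pair t).measurable_right

/-- Up to a null set `W` is a function of the noise up to time `t`, which is independent of the next
noise pair. -/
theorem indepFun_next (hN : IsNoise P ξ s t₂ t₄) {t : ℤ} {W : Ω → ℝ}
    (hW : AEStronglyMeasurable[noisePast ξ t] W P) :
    IndepFun (fun ω => (W ω, (ξ t ω).2)) (ξ (t + 1)) P := by
  have hind : Indep (noisePast ξ t) (MeasurableSpace.comap (ξ (t + 1)) inferInstance) P := by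
    have := indep_iSup_of_disjoint (S := Set.Iic t) (T := {t + 1})
      (fun i => (hN.measurable i).comap_le) hN.indep.iIndep (by simp)
    rwa [iSup_singleton] at this
  obtain ⟨W', hW', hae⟩ := hW
  have h1 : IndepFun (fun ω => (W' ω, (ξ t ω).2)) (ξ (t + 1)) P := by
    rw [IndepFun_iff_Indep]
    refine indep_of_indep_of_le_left hind (Measurable.comap_le ?_)
    exact hW'.measurable.prodMk (measurable_snd.comp (measurable_noisePast le_rfl))
  refine h1.congr ?_ .rfl
  filter_upwards [hae] with ω hω
  rw [hω]

theorem isStep (hN : IsNoise P ξ s t₂ t₄) {t : ℤ} {W W' : Ω → ℝ}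
    (hW : AEStronglyMeasurable[noisePast ξ t] W P) (h2 : MemLp W 2 P)
    (h2' : MemLp (fun ω => (ξ t ω).2 * W ω) 2 P)
    (hW' : W' =ᵐ[P] fun ω => (θ + α * (ξ t ω).2 + (ξ (t + 1) ω).2) * W ω + c * (ξ (t + 1) ω).1) :
    IsStep P θ α c (fun ω => (ξ (t + 1) ω).1) (fun ω => (ξ (t + 1) ω).2) (fun ω => (ξ t ω).2)
      W W' :=
  ⟨h2, h2', hN.indepFun_next hW, hW'⟩

end IsNoise

/-- The solution of the recursion `y_t = θ_t y_{t-1} + c ε_t` driven by `z = (ε, η)` and started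
at time `a` from the value `x`, evaluated at time `a + k`. -/
noncomputable def path (θ α c x : ℝ) (z : ℤ → ℝ × ℝ) (a : ℤ) : ℕ → ℝ
  | 0 => x
  | k + 1 => (θ + α * (z (a + k)).2 + (z (a + k + 1)).2) * path θ α c x z a k +
      c * (z (a + k + 1)).1

theorem measurable_path (a : ℤ) (k : ℕ) : Measurable fun z => path θ α c x z a k := by
  induction k with
  | zero => exact measurable_const
  | succ k ih =>
    simp only [path]
    fun_prop

theorem path_seqShift (z : ℤ → ℝ × ℝ) (a h : ℤ) (k : ℕ) :
    path θ α c x (seqShift h z) a k = path θ α c x z (a + h) k := by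
  induction k with
  | zero => rfl
  | succ k ih => simp only [path, ih, seqShift, add_right_comm a h, add_right_comm _ h (1 : ℤ)]

/-- Variation of constants: the forced path started at zero, plus the homogeneous path started at
one times the initial value. -/
theorem eq_path_add_path_mul {z : ℤ → ℝ × ℝ} {y : ℤ → ℝ}
    (hy : ∀ t, y t = (θ + α * (z (t - 1)).2 + (z t).2) * y (t - 1) + (z t).1) (a : ℤ) (k : ℕ) :
    y (a + k) = path θ α 1 0 z a k + path θ α 0 1 z a k * y a := by
  induction k with
  | zero => simp [path]
  | succ k ih =>
    rw [hy, show a + ((k + 1 : ℕ) : ℤ) - 1 = a + k by push_cast; ring,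
      show a + ((k + 1 : ℕ) : ℤ) = a + k + 1 by push_cast; ring, ih]
    simp only [path]
    ring

omit [MeasurableSpace Ω] in
theorem measurable_noisePast_path (a : ℤ) (k : ℕ) :
    Measurable[noisePast ξ (a + k)] fun ω => path θ α c x (fun t => ξ t ω) a k := by
  induction k with
  | zero => exact measurable_const
  | succ k ih =>
    have h1 := ih.mono (noisePast_mono (ξ := ξ) (show a + k ≤ a + (k + 1 : ℕ) by simp)) le_rfl
    have h2 : Measurable[noisePast ξ (a + (k + 1 : ℕ))] (ξ (a + k)) :=
      measurable_noisePast (by simp)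
    have h3 : Measurable[noisePast ξ (a + (k + 1 : ℕ))] (ξ (a + k + 1)) :=
      measurable_noisePast (by push_cast; linarith)
    simp only [path]
    fun_prop

variable [IsProbabilityMeasure P]

theorem IsNoisePair.memLp_right {e h : Ω → ℝ} (hp : IsNoisePair P e h s t₂ t₄) : MemLp h 2 P :=
  (memLp_two_iff_integrable_sq hp.measurable_right.aestronglyMeasurable).2
    (integrable_pow_of_le hp.measurable_right (by lia) hp.integrable_right)

theorem IsNoise.isStep_path (hN : IsNoise P ξ s t₂ t₄) (a : ℤ) (k : ℕ) :
    IsStep P θ α c (fun ω => (ξ (a + k + 1) ω).1) (fun ω => (ξ (a + k + 1) ω).2)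
      (fun ω => (ξ (a + k) ω).2) (fun ω => path θ α c x (fun t => ξ t ω) a k)
      (fun ω => path θ α c x (fun t => ξ t ω) a (k + 1)) := by
  have hm : ∀ k : ℕ, AEStronglyMeasurable[noisePast ξ (a + k)]
      (fun ω => path θ α c x (fun t => ξ t ω) a k) P := fun k =>
    (measurable_noisePast_path a k).stronglyMeasurable.aestronglyMeasurable
  induction k with
  | zero =>
    refine hN.isStep (hm 0) (memLp_const x) ?_ .rfl
    exact ((hN.pair _).memLp_right.mul_const x)
  | succ k ih =>
    have h1 := ih.memLp_next (hN.pair (a + k + 1))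
    refine hN.isStep (hm (k + 1)) h1.1 ?_ .rfl
    rw [show a + ((k + 1 : ℕ) : ℤ) = a + k + 1 by push_cast; ring]
    exact h1.2

/-- The starting vector is that of the constant `1`: `(1, E[η], E[η²])`. -/
theorem IsNoise.momentVec_path_zero_one (hN : IsNoise P ξ s t₂ t₄) (a : ℤ) (k : ℕ) :
    momentVec P (fun ω => (ξ (a + k) ω).2) (fun ω => path θ α 0 1 (fun t => ξ t ω) a k) =
      matM θ α t₂ t₄ ^ k *ᵥ ![1, 0, t₂] := by
  induction k with
  | zero =>
    have h1 := (hN.pair a).right_one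
    have h2 := (hN.pair a).right_two
    simp only [pow_one] at h1
    simp [momentVec, path, h1, h2]
  | succ k ih =>
    rw [show a + ((k + 1 : ℕ) : ℤ) = a + k + 1 by push_cast; ring,
      (hN.isStep_path a k).momentVec_next (hN.pair _), ih,
      pow_succ' (matM θ α t₂ t₄) k, ← Matrix.mulVec_mulVec]
    simp

/-- These partial sums of a convergent series bound the forced paths in `L²` uniformly in their
length. -/
theorem IsNoise.momentVec_path_one_zero (hN : IsNoise P ξ s t₂ t₄) (a : ℤ) (k : ℕ) :
    momentVec P (fun ω => (ξ (a + k) ω).2) (fun ω => path θ α 1 0 (fun t => ξ t ω) a k) =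
      ∑ j ∈ Finset.range k, matM θ α t₂ t₄ ^ j *ᵥ ![s, 0, t₂ * s] := by
  induction k with
  | zero =>
    simp only [momentVec, path]
    funext i
    fin_cases i <;> simp
  | succ k ih =>
    rw [show a + ((k + 1 : ℕ) : ℤ) = a + k + 1 by push_cast; ring,
      (hN.isStep_path a k).momentVec_next (hN.pair _), ih, Finset.sum_range_succ',
      Matrix.mulVec_sum]
    simp [pow_succ', Matrix.mulVec_mulVec]

theorem IsNoise.integral_path_one_zero (hN : IsNoise P ξ s t₂ t₄) (a : ℤ) (k : ℕ) :
    ∫ ω, path θ α 1 0 (fun t => ξ t ω) a k ∂P = 0 ∧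
      ∫ ω, (ξ (a + k) ω).2 * path θ α 1 0 (fun t => ξ t ω) a k ∂P = 0 := by
  induction k with
  | zero => simp [path]
  | succ k ih =>
    rw [show a + ((k + 1 : ℕ) : ℤ) = a + k + 1 by push_cast; ring]
    exact (hN.isStep_path a k).integral_next (hN.pair _) ih.1 ih.2

omit [IsProbabilityMeasure P] in
theorem eLpNorm_two_eq_ofReal_sqrt {f : Ω → ℝ} (hf : MemLp f 2 P) :
    eLpNorm f 2 P = ENNReal.ofReal (√(∫ ω, f ω ^ 2 ∂P)) := by
  rw [hf.eLpNorm_eq_integral_rpow_norm (by simp) (by simp), Real.sqrt_eq_rpow]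
  simp

theorem tendsto_measure_le_abs {f : Ω → ℝ} (hf : Measurable f) :
    Tendsto (fun n : ℕ => P {ω | (n : ℝ) ≤ |f ω|}) atTop (𝓝 0) := by
  have h := tendsto_measure_iInter_atTop (μ := P) (s := fun n : ℕ => {ω | (n : ℝ) ≤ |f ω|})
    (fun n => (measurableSet_le measurable_const hf.abs).nullMeasurableSet)
    (fun m n hmn ω hω => le_trans (Nat.cast_le.2 hmn) (Set.mem_ofPred.1 hω)) ⟨0, measure_ne_top _ _⟩
  have h0 : ⋂ n : ℕ, {ω | (n : ℝ) ≤ |f ω|} = ∅ := by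
    rw [Set.eq_empty_iff_forall_notMem]
    intro ω hω
    obtain ⟨n, hn⟩ := exists_nat_gt |f ω|
    exact absurd (Set.mem_iInter.1 hω n) (not_le.2 hn)
  rwa [h0, measure_empty] at h

/-- The product of a sequence tending to zero in probability and of identically distributed random
variables tends to zero in probability. -/
theorem tendstoInMeasure_mul_zero {p y : ℕ → Ω → ℝ} {y₀ : Ω → ℝ}
    (hp : TendstoInMeasure P p atTop 0) (hy : ∀ k, IdentDistrib (y k) y₀ P P)
    (hy₀ : Measurable y₀) : TendstoInMeasure P (fun k ω => p k ω * y k ω) atTop 0 := by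
  rw [tendstoInMeasure_iff_norm] at hp ⊢
  intro ε hε
  rw [ENNReal.tendsto_nhds_zero]
  intro δ hδ
  have hδ2 : 0 < δ / 2 := ENNReal.half_pos hδ.ne'
  -- A common law makes the `y k` tight: one level `n` is exceeded with probability at most `δ / 2`,
  -- whatever `k`.
  obtain ⟨n, hn, hn1⟩ := ((ENNReal.tendsto_nhds_zero.1 (tendsto_measure_le_abs (P := P) hy₀) _
    hδ2).and (eventually_gt_atTop 0)).exists
  have hn0 : (0 : ℝ) < n := Nat.cast_pos.2 hn1
  filter_upwards [ENNReal.tendsto_nhds_zero.1 (hp (ε / n) (by positivity)) _ hδ2] with k hk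
  have h1 : P {ω | (n : ℝ) ≤ |y k ω|} = P {ω | (n : ℝ) ≤ |y₀ ω|} :=
    (hy k).measure_mem_eq (s := {r : ℝ | (n : ℝ) ≤ |r|})
      (measurableSet_le measurable_const measurable_id.abs)
  have hsub : {ω | ε ≤ ‖p k ω * y k ω - (0 : Ω → ℝ) ω‖} ⊆
      {ω | ε / n ≤ ‖p k ω - (0 : Ω → ℝ) ω‖} ∪ {ω | (n : ℝ) ≤ |y k ω|} := by
    intro ω hω
    by_contra hcon
    simp only [Set.mem_ofPred_eq, Set.mem_union, Pi.zero_apply, sub_zero, Real.norm_eq_abs,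
      abs_mul, not_or, not_le] at hω hcon
    obtain ⟨h2, h3⟩ := hcon
    rw [lt_div_iff₀ hn0] at h2
    have := mul_le_mul_of_nonneg_left h3.le (abs_nonneg (p k ω))
    linarith
  calc _ ≤ _ := measure_mono hsub
    _ ≤ _ := measure_union_le _ _
    _ ≤ δ / 2 + δ / 2 := add_le_add hk (h1.trans_le hn)
    _ = δ := ENNReal.add_halves δ

end RCAR

/-! ### The stationary solution as a limit of finite paths. -/

namespace RCAR

variable {Ω : Type*} [MeasurableSpace Ω] {P : Measure Ω} [IsProbabilityMeasure P]
  {ξ : ℤ → Ω → ℝ × ℝ} {X : ℤ → Ω → ℝ} {θ α c x s t₂ t₄ : ℝ}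

-- Taking `limUnder` everywhere gives an `m`-measurable version of the limit, although the
-- exceptional null set need not belong to `m`.
omit [IsProbabilityMeasure P] in
theorem aestronglyMeasurable_of_stronglyMeasurable_of_tendsto {m : MeasurableSpace Ω}
    {f : ℕ → Ω → ℝ} {g : Ω → ℝ} (hf : ∀ n, StronglyMeasurable[m] (f n))
    (hg : ∀ᵐ ω ∂P, Tendsto (fun n => f n ω) atTop (𝓝 (g ω))) : AEStronglyMeasurable[m] g P :=
  ⟨fun ω => limUnder atTop fun n => f n ω, StronglyMeasurable.limUnder hf, by
    filter_upwards [hg] with ω hω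
    exact hω.limUnder_eq.symm⟩

namespace IsNoise

theorem memLp_path (hN : IsNoise P ξ s t₂ t₄) (a : ℤ) (k : ℕ) :
    MemLp (fun ω => path θ α c x (fun t => ξ t ω) a k) 2 P :=
  (hN.isStep_path a k).memLp

theorem tendsto_eLpNorm_path_zero_one (hN : IsNoise P ξ s t₂ t₄)
    (hρ : spectralRadius ℂ ((matM θ α t₂ t₄).map (algebraMap ℝ ℂ)) < 1) (t : ℤ) :
    Tendsto (fun k : ℕ => eLpNorm (fun ω => path θ α 0 1 (fun t => ξ t ω) (t - k) k) 2 P) atTop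
      (𝓝 0) := by
  have h1 := (Matrix.summable_norm_pow_mulVec hρ ![1, 0, t₂]).tendsto_atTop_zero
  have h2 := ((tendsto_pi_nhds.1 (tendsto_zero_iff_norm_tendsto_zero.2 h1)) 0).sqrt
  have h3 := ENNReal.tendsto_ofReal h2
  simp only [Pi.zero_apply, Real.sqrt_zero, ENNReal.ofReal_zero] at h3
  refine h3.congr fun k => ?_
  rw [eLpNorm_two_eq_ofReal_sqrt (hN.memLp_path _ _), ← hN.momentVec_path_zero_one (t - k) k]
  rfl

theorem tendstoInMeasure_path_zero_one (hN : IsNoise P ξ s t₂ t₄)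
    (hρ : spectralRadius ℂ ((matM θ α t₂ t₄).map (algebraMap ℝ ℂ)) < 1) (t : ℤ) :
    TendstoInMeasure P (fun (k : ℕ) ω => path θ α 0 1 (fun t => ξ t ω) (t - k) k) atTop 0 := by
  refine tendstoInMeasure_of_tendsto_eLpNorm (p := 2) (by simp)
    (fun k => (hN.memLp_path _ _).1) aestronglyMeasurable_zero ?_
  simpa using hN.tendsto_eLpNorm_path_zero_one hρ t

omit [IsProbabilityMeasure P] in
theorem map_eq_infinitePi (hN : IsNoise P ξ s t₂ t₄) : P.map (fun ω i => ξ i ω) =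
    Measure.infinitePi fun _ : ℤ => P.map (ξ 0) := by
  rw [hN.indep.map_fun_eq_infinitePi_map hN.measurable]
  congr 1
  funext i
  exact hN.map_eq i

end IsNoise

/-- A solution of `X_t = θ_t X_{t-1} + ε_t` whose one-dimensional laws do not depend on time. -/
structure IsSolution (P : Measure Ω) (θ α : ℝ) (ξ : ℤ → Ω → ℝ × ℝ) (X : ℤ → Ω → ℝ) : Prop where
  measurable : ∀ t, Measurable (X t)
  recurrence : ∀ᵐ ω ∂P, ∀ t, X t ω =
    (θ + α * (ξ (t - 1) ω).2 + (ξ t ω).2) * X (t - 1) ω + (ξ t ω).1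
  identDistrib : ∀ t, IdentDistrib (X t) (X 0) P P

namespace IsSolution

omit [IsProbabilityMeasure P] in
theorem ae_eq_path (hX : IsSolution P θ α ξ X) (t : ℤ) (k : ℕ) :
    ∀ᵐ ω ∂P, X t ω = path θ α 1 0 (fun t => ξ t ω) (t - k) k +
      path θ α 0 1 (fun t => ξ t ω) (t - k) k * X (t - k) ω := by
  filter_upwards [hX.recurrence] with ω hω
  have := eq_path_add_path_mul (z := fun t => ξ t ω) (y := fun t => X t ω) hω (t - k) k
  rwa [sub_add_cancel] at this

/-- The error is the homogeneous path times `X (t - k)`. No moment of `X` is known yet, so tightness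
of its common law replaces an `L²` bound. -/
theorem tendstoInMeasure_path (hX : IsSolution P θ α ξ X) (hN : IsNoise P ξ s t₂ t₄)
    (hρ : spectralRadius ℂ ((matM θ α t₂ t₄).map (algebraMap ℝ ℂ)) < 1) (t : ℤ) :
    TendstoInMeasure P (fun (k : ℕ) ω => path θ α 1 0 (fun t => ξ t ω) (t - k) k) atTop (X t) := by
  have h := tendstoInMeasure_mul_zero (hN.tendstoInMeasure_path_zero_one hρ t)
    (y := fun k => X (t - k)) (fun k => hX.identDistrib (t - k)) (hX.measurable 0)
  rw [tendstoInMeasure_iff_norm] at h ⊢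
  intro ε hε
  refine (h ε hε).congr fun k => measure_congr ?_
  filter_upwards [hX.ae_eq_path t k] with ω hω
  apply propext
  change ε ≤ _ ↔ ε ≤ _
  rw [hω, Pi.zero_apply, sub_zero, ← norm_neg (_ - _)]
  congr! 2
  ring

/-- Fatou along an a.e. convergent subsequence of forced paths, whose second moments, also when
weighted by `η`, are at most `C`. -/
theorem memLp (hX : IsSolution P θ α ξ X) (hN : IsNoise P ξ s t₂ t₄)
    (hρ : spectralRadius ℂ ((matM θ α t₂ t₄).map (algebraMap ℝ ℂ)) < 1) (t : ℤ) :
    MemLp (X t) 2 P ∧ MemLp (fun ω => (ξ t ω).2 * X t ω) 2 P := by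
  obtain ⟨ns, -, hns⟩ := (hX.tendstoInMeasure_path hN hρ t).exists_seq_tendsto_ae
  have hsum := Matrix.summable_norm_pow_mulVec hρ ![s, 0, t₂ * s]
  set C := ∑' j : ℕ, ‖matM θ α t₂ t₄ ^ j *ᵥ ![s, 0, t₂ * s]‖
  have hbound : ∀ (k : ℕ) (i : Fin 3), momentVec P (fun ω => (ξ (t - k + k) ω).2)
      (fun ω => path θ α 1 0 (fun t => ξ t ω) (t - k) k) i ≤ C := by
    intro k i
    rw [hN.momentVec_path_one_zero]
    refine (le_abs_self _).trans ((norm_le_pi_norm (∑ j ∈ Finset.range k,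
      matM θ α t₂ t₄ ^ j *ᵥ ![s, 0, t₂ * s]) i).trans ((norm_sum_le _ _).trans ?_))
    exact hsum.sum_le_tsum _ fun j _ => norm_nonneg _
  have hη : AEStronglyMeasurable (fun ω => (ξ t ω).2) P :=
    (hN.measurable t).snd.aestronglyMeasurable
  have hmul : ∀ k : ℕ, MemLp
      (fun ω => (ξ t ω).2 * path θ α 1 0 (fun t => ξ t ω) (t - k) k) 2 P := by
    intro k
    have := (hN.isStep_path (θ := θ) (α := α) (c := 1) (x := 0) (t - k) k).memLp_mul
    rwa [sub_add_cancel] at this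
  refine ⟨⟨(hX.measurable t).aestronglyMeasurable, ?_⟩,
    ⟨hη.mul (hX.measurable t).aestronglyMeasurable, ?_⟩⟩
  · refine (Lp.eLpNorm_le_of_ae_tendsto (C := ENNReal.ofReal √C) (.of_forall fun j => ?_)
      (fun j => (hN.memLp_path _ _).1) hns).trans_lt ENNReal.ofReal_lt_top
    rw [eLpNorm_two_eq_ofReal_sqrt (hN.memLp_path _ _)]
    exact ENNReal.ofReal_le_ofReal (Real.sqrt_le_sqrt (hbound (ns j) 0))
  · refine (Lp.eLpNorm_le_of_ae_tendsto (u := atTop) (C := ENNReal.ofReal √C)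
      (f := fun j ω => (ξ t ω).2 * path θ α 1 0 (fun t => ξ t ω) (t - ns j) (ns j))
      (.of_forall fun j => ?_) (fun j => (hmul (ns j)).1) ?_).trans_lt ENNReal.ofReal_lt_top
    · rw [eLpNorm_two_eq_ofReal_sqrt (hmul _)]
      have := hbound (ns j) 2
      rw [sub_add_cancel] at this
      exact ENNReal.ofReal_le_ofReal (Real.sqrt_le_sqrt this)
    · filter_upwards [hns] with ω hω
      exact hω.const_mul _

theorem aestronglyMeasurable_noisePast (hX : IsSolution P θ α ξ X) (hN : IsNoise P ξ s t₂ t₄)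
    (hρ : spectralRadius ℂ ((matM θ α t₂ t₄).map (algebraMap ℝ ℂ)) < 1) (t : ℤ) :
    AEStronglyMeasurable[noisePast ξ t] (X t) P := by
  obtain ⟨ns, -, hns⟩ := (hX.tendstoInMeasure_path hN hρ t).exists_seq_tendsto_ae
  refine aestronglyMeasurable_of_stronglyMeasurable_of_tendsto (fun j => ?_) hns
  have := (measurable_noisePast_path (ξ := ξ) (θ := θ) (α := α) (c := 1) (x := 0)
    (t - ns j) (ns j)).stronglyMeasurable
  rwa [sub_add_cancel] at this

theorem isStep (hX : IsSolution P θ α ξ X) (hN : IsNoise P ξ s t₂ t₄)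
    (hρ : spectralRadius ℂ ((matM θ α t₂ t₄).map (algebraMap ℝ ℂ)) < 1) (t : ℤ) :
    IsStep P θ α 1 (fun ω => (ξ (t + 1) ω).1) (fun ω => (ξ (t + 1) ω).2) (fun ω => (ξ t ω).2)
      (X t) (X (t + 1)) := by
  refine hN.isStep (hX.aestronglyMeasurable_noisePast hN hρ t) (hX.memLp hN hρ t).1
    (hX.memLp hN hρ t).2 ?_
  filter_upwards [hX.recurrence] with ω hω
  rw [hω (t + 1), add_sub_cancel_right, one_mul]

/-- Forced paths are centred, so the mean of `X 0` is that of the remainder, which Cauchy–Schwarz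
sends to zero. -/
theorem integral_eq_zero (hX : IsSolution P θ α ξ X) (hN : IsNoise P ξ s t₂ t₄)
    (hρ : spectralRadius ℂ ((matM θ α t₂ t₄).map (algebraMap ℝ ℂ)) < 1) :
    ∫ ω, X 0 ω ∂P = 0 := by
  have hX2 := fun t => (hX.memLp hN hρ t).1
  have hle : ∀ k : ℕ, ‖∫ ω, X 0 ω ∂P‖ₑ ≤
      eLpNorm (fun ω => path θ α 0 1 (fun t => ξ t ω) (0 - k) k) 2 P * eLpNorm (X 0) 2 P := by
    intro k
    have hp : MemLp (fun ω => path θ α 0 1 (fun t => ξ t ω) (0 - k) k) 2 P := hN.memLp_path _ _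
    have h1 : ∫ ω, X 0 ω ∂P =
        ∫ ω, path θ α 0 1 (fun t => ξ t ω) (0 - k) k * X (0 - k) ω ∂P := by
      have hpX : Integrable
          (fun ω => path θ α 0 1 (fun t => ξ t ω) (0 - k) k * X (0 - k) ω) P :=
        hp.integrable_mul (hX2 _)
      rw [integral_congr_ae (hX.ae_eq_path 0 k), integral_add
        ((hN.memLp_path _ _).integrable one_le_two) hpX, (hN.integral_path_one_zero _ _).1, zero_add]
    rw [h1]
    refine (enorm_integral_le_lintegral_enorm _).trans ?_
    rw [← eLpNorm_one_eq_lintegral_enorm]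
    refine (eLpNorm_smul_le_mul_eLpNorm (p := 2) (q := 2) (r := 1) (hX2 _).1 hp.1).trans_eq ?_
    rw [(hX.identDistrib (0 - k)).eLpNorm_eq]
  have hlim := ENNReal.Tendsto.mul_const (hN.tendsto_eLpNorm_path_zero_one hρ 0)
    (.inr (hX2 0).2.ne)
  rw [zero_mul] at hlim
  have := ge_of_tendsto' hlim hle
  simpa using this

/-- The solution is a measurable function of the shifted noise. -/
theorem exists_factor (hX : IsSolution P θ α ξ X) (hN : IsNoise P ξ s t₂ t₄)
    (hρ : spectralRadius ℂ ((matM θ α t₂ t₄).map (algebraMap ℝ ℂ)) < 1) :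
    ∃ F : (ℤ → ℝ × ℝ) → ℝ, Measurable F ∧
      ∀ t, ∀ᵐ ω ∂P, X t ω = F (seqShift t fun i => ξ i ω) := by
  set Z : Ω → ℤ → ℝ × ℝ := fun ω i => ξ i ω with hZ
  have hZm : Measurable Z := measurable_pi_lambda _ hN.measurable
  obtain ⟨ns, -, hns⟩ := (hX.tendstoInMeasure_path hN hρ 0).exists_seq_tendsto_ae
  have hm : AEStronglyMeasurable[MeasurableSpace.comap Z inferInstance] (X 0) P := by
    refine aestronglyMeasurable_of_stronglyMeasurable_of_tendsto (fun j => ?_) hns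
    exact ((measurable_path (θ := θ) (α := α) (c := 1) (x := 0) (0 - ns j) (ns j)).comp
      (comap_measurable Z)).stronglyMeasurable
  obtain ⟨g, hg, hXg⟩ := hm
  obtain ⟨F, hF, rfl⟩ := hg.measurable.exists_eq_measurable_comp
  refine ⟨F, hF, fun t => ?_⟩
  have hlaw : P.map Z = Measure.infinitePi fun _ : ℤ => P.map (ξ 0) := hN.map_eq_infinitePi
  have : IsProbabilityMeasure (P.map (ξ 0)) :=
    Measure.isProbabilityMeasure_map (hN.measurable 0).aemeasurable
  have h0 : TendstoInMeasure P (fun (k : ℕ) ω => path θ α 1 0 (Z ω) (0 - k) k) atTop (F ∘ Z) :=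
    (hX.tendstoInMeasure_path hN hρ 0).congr_right hXg
  -- Shift invariance of the noise law carries the convergence at time `0` to time `t`; uniqueness
  -- of limits in measure then identifies `X t`.
  have ht : TendstoInMeasure P (fun (k : ℕ) ω => path θ α 1 0 (Z ω) (t - k) k) atTop
      (fun ω => F (seqShift t (Z ω))) := by
    rw [tendstoInMeasure_iff_norm] at h0 ⊢
    intro ε hε
    refine (h0 ε hε).congr fun k => ?_
    set S : Set (ℤ → ℝ × ℝ) := {z | ε ≤ ‖path θ α 1 0 z (0 - k) k - F z‖} with hS
    have hSm : MeasurableSet S :=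
      measurableSet_le measurable_const ((measurable_path _ _).sub hF).norm
    calc _ = P (Z ⁻¹' S) := rfl
      _ = P (Z ⁻¹' (seqShift t ⁻¹' S)) := by
        rw [← Measure.map_apply hZm hSm, ← Measure.map_apply hZm (measurable_seqShift t hSm), hlaw,
          (measurePreserving_seqShift _ t).measure_preimage hSm.nullMeasurableSet]
      _ = _ := by
        congr 1
        ext ω
        simp only [hS, Set.mem_preimage, Set.mem_ofPred_eq, path_seqShift]
        rw [show (0 : ℤ) - k + t = t - k by ring]
  exact tendstoInMeasure_ae_unique (hX.tendstoInMeasure_path hN hρ t) ht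

end IsSolution

end RCAR

/-! ### Ergodic averages and second-order structure. -/

namespace RCAR

variable {Ω : Type*} [MeasurableSpace Ω] {P : Measure Ω} [IsProbabilityMeasure P]
  {ξ : ℤ → Ω → ℝ × ℝ} {X : ℤ → Ω → ℝ} {θ α s t₂ t₄ : ℝ}

theorem IsNoise.integral_comp_seqShift (hN : IsNoise P ξ s t₂ t₄) {G : (ℤ → ℝ × ℝ) → ℝ}
    (hG : Measurable G) (t : ℤ) :
    ∫ ω, G (seqShift t fun i => ξ i ω) ∂P = ∫ ω, G (fun i => ξ i ω) ∂P := by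
  have hZm : Measurable fun ω i => ξ i ω := measurable_pi_lambda _ hN.measurable
  have : IsProbabilityMeasure (P.map (ξ 0)) :=
    Measure.isProbabilityMeasure_map (hN.measurable 0).aemeasurable
  rw [← integral_map (φ := fun ω i => ξ i ω) (f := fun z => G (seqShift t z)) hZm.aemeasurable
      (hG.comp (measurable_seqShift t)).aestronglyMeasurable,
    ← integral_map (φ := fun ω i => ξ i ω) (f := G) hZm.aemeasurable hG.aestronglyMeasurable,
    hN.map_eq_infinitePi,
    ← integral_map (φ := seqShift t) (f := G) (measurable_seqShift t).aemeasurable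
      hG.aestronglyMeasurable, (measurePreserving_seqShift _ t).map_eq]

theorem IsNoise.ae_tendsto_average (hN : IsNoise P ξ s t₂ t₄) {G : (ℤ → ℝ × ℝ) → ℝ}
    (hG : Measurable G) (hGi : Integrable (fun ω => G fun i => ξ i ω) P) :
    ∀ᵐ ω ∂P, Tendsto (fun n : ℕ => (n : ℝ)⁻¹ *
      ∑ i ∈ Finset.range n, G (seqShift i fun j => ξ j ω)) atTop
      (𝓝 (∫ ω, G (fun i => ξ i ω) ∂P)) := by
  have hZm : Measurable fun ω i => ξ i ω := measurable_pi_lambda _ hN.measurable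
  have : IsProbabilityMeasure (P.map (ξ 0)) :=
    Measure.isProbabilityMeasure_map (hN.measurable 0).aemeasurable
  have h1 : Integrable G (P.map fun ω i => ξ i ω) :=
    (integrable_map_measure hG.aestronglyMeasurable hZm.aemeasurable).2 hGi
  rw [← integral_map (φ := fun ω i => ξ i ω) (f := G) hZm.aemeasurable hG.aestronglyMeasurable]
  rw [hN.map_eq_infinitePi] at h1
  have h2 := (ergodic_seqShift_infinitePi (P.map (ξ 0))).ae_tendsto_birkhoffAverage hG h1
  rw [← hN.map_eq_infinitePi] at h2
  filter_upwards [ae_of_ae_map hZm.aemeasurable h2] with ω hω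
  refine hω.congr fun n => ?_
  simp only [birkhoffAverage, birkhoffSum, iterate_seqShift, smul_eq_mul]

/-- Normalised sums of a real sequence and of its lagged products determine `sigmaHat`. -/
theorem tendsto_sigmaHat {Ω : Type*} {X : ℤ → Ω → ℝ} {ω : Ω} {u r : ℝ} (hu : u ≠ 0)
    (hA : Tendsto (fun n : ℕ => (n : ℝ)⁻¹ * ∑ i ∈ Finset.range n, X i ω ^ 2) atTop (𝓝 u))
    (hB : Tendsto (fun n : ℕ => (n : ℝ)⁻¹ * ∑ i ∈ Finset.range n, X i ω * X (i + 1) ω)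
      atTop (𝓝 r))
    (hC : Tendsto (fun n : ℕ => (n : ℝ)⁻¹ * ∑ i ∈ Finset.range n, X (i + 1) ω ^ 2) atTop (𝓝 u)) :
    Tendsto (fun n : ℕ => sigmaHat X n ω) atTop (𝓝 ((1 - (r / u) ^ 2) * u)) := by
  have hsum : ∀ (n : ℕ) (f : ℕ → ℝ), ∑ t ∈ Finset.Icc 1 n, f t = ∑ i ∈ Finset.range n, f (i + 1) :=
    fun n f => by
      rw [Finset.range_eq_Ico, Finset.sum_Ico_add' f 0 n 1]
      rfl
  have hθ : Tendsto (fun n : ℕ => thetaHat X n ω) atTop (𝓝 (r / u)) := by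
    refine (hB.div hA hu).congr' ?_
    filter_upwards [eventually_gt_atTop 0] with n hn
    have hn0 : (n : ℝ)⁻¹ ≠ 0 := inv_ne_zero (Nat.cast_ne_zero.2 hn.ne')
    rw [thetaHat, hsum n fun t => X ((t : ℤ) - 1) ω * X (t : ℤ) ω,
      hsum n fun t => X ((t : ℤ) - 1) ω ^ 2]
    simp only [Nat.cast_add, Nat.cast_one, add_sub_cancel_right]
    exact mul_div_mul_left _ _ hn0
  -- Expanding the squared residuals leaves only the three averages and `thetaHat`.
  have hlim := (hC.sub ((hθ.mul hB).const_mul 2)).add ((hθ.pow 2).mul hA)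
  have hval : u - 2 * (r / u * r) + (r / u) ^ 2 * u = (1 - (r / u) ^ 2) * u := by
    field_simp
    ring
  rw [hval] at hlim
  refine hlim.congr fun n => ?_
  rw [sigmaHat, hsum n fun t => residual X n (t : ℤ) ω ^ 2]
  simp only [residual, Nat.cast_add, Nat.cast_one, add_sub_cancel_right]
  have hexp : ∀ i : ℕ, (X (i + 1) ω - thetaHat X n ω * X i ω) ^ 2 = X (i + 1) ω ^ 2
      - 2 * thetaHat X n ω * (X i ω * X (i + 1) ω) + thetaHat X n ω ^ 2 * X i ω ^ 2 :=
    fun i => by ring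
  simp only [hexp, Finset.sum_add_distrib, Finset.sum_sub_distrib, ← Finset.mul_sum]
  ring

namespace IsSolution

/-- Equal marginal laws of `X` say nothing about the pair `(η_t, X_t)`; its stationarity comes from
writing `X` as a factor of the noise. -/
theorem momentVec_fixed (hX : IsSolution P θ α ξ X) (hN : IsNoise P ξ s t₂ t₄)
    (hρ : spectralRadius ℂ ((matM θ α t₂ t₄).map (algebraMap ℝ ℂ)) < 1) :
    momentVec P (fun ω => (ξ 0 ω).2) (X 0) =
      matM θ α t₂ t₄ *ᵥ momentVec P (fun ω => (ξ 0 ω).2) (X 0) + ![s, 0, t₂ * s] := by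
  obtain ⟨F, hF, hXF⟩ := hX.exists_factor hN hρ
  have h1 := (hX.isStep hN hρ 0).momentVec_next (hN.pair _)
  rw [zero_add, one_pow, one_smul] at h1
  rw [← h1]
  have key : ∀ Φ : ℝ × ℝ → ℝ, Measurable Φ →
      ∫ ω, Φ ((ξ 0 ω).2, X 0 ω) ∂P = ∫ ω, Φ ((ξ 1 ω).2, X 1 ω) ∂P := by
    intro Φ hΦ
    have hG : Measurable fun z : ℤ → ℝ × ℝ => Φ ((z 0).2, F z) := by fun_prop
    have h2 := hN.integral_comp_seqShift hG 0
    have h3 := hN.integral_comp_seqShift hG 1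
    have h4 : ∀ t : ℤ, ∫ ω, Φ ((ξ t ω).2, X t ω) ∂P =
        ∫ ω, Φ ((seqShift t (fun i => ξ i ω) 0).2, F (seqShift t fun i => ξ i ω)) ∂P := by
      intro t
      refine integral_congr_ae ?_
      filter_upwards [hXF t] with ω hω
      simp only [hω, seqShift, zero_add]
    rw [h4, h4, h2, h3]
  unfold momentVec
  rw [key (fun p => p.2 ^ 2) (by fun_prop), key (fun p => p.1 * p.2 ^ 2) (by fun_prop),
    key (fun p => (p.1 * p.2) ^ 2) (by fun_prop)]

theorem ae_tendsto_sigmaHat (hX : IsSolution P θ α ξ X) (hN : IsNoise P ξ s t₂ t₄)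
    (hρ : spectralRadius ℂ ((matM θ α t₂ t₄).map (algebraMap ℝ ℂ)) < 1)
    (hu : ∫ ω, X 0 ω ^ 2 ∂P ≠ 0) :
    ∀ᵐ ω ∂P, Tendsto (fun n : ℕ => sigmaHat X n ω) atTop
      (𝓝 ((1 - ((∫ ω, X 0 ω * X 1 ω ∂P) / ∫ ω, X 0 ω ^ 2 ∂P) ^ 2) * ∫ ω, X 0 ω ^ 2 ∂P)) := by
  obtain ⟨F, hF, hXF⟩ := hX.exists_factor hN hρ
  have hX2 := fun t => (hX.memLp hN hρ t).1
  have key : ∀ Φ : ℝ × ℝ → ℝ, Measurable Φ → Integrable (fun ω => Φ (X 0 ω, X 1 ω)) P →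
      ∀ᵐ ω ∂P, Tendsto (fun n : ℕ => (n : ℝ)⁻¹ *
        ∑ i ∈ Finset.range n, Φ (X i ω, X (i + 1) ω)) atTop (𝓝 (∫ ω, Φ (X 0 ω, X 1 ω) ∂P)) := by
    intro Φ hΦ hint
    have hG : Measurable fun z : ℤ → ℝ × ℝ => Φ (F z, F (seqShift 1 z)) :=
      hΦ.comp (hF.prodMk (hF.comp (measurable_seqShift 1)))
    have hcomp : ∀ (t : ℤ) (z : ℤ → ℝ × ℝ), seqShift 1 (seqShift t z) = seqShift (t + 1) z :=
      fun t z => funext fun i => by simp only [seqShift]; congr 1; ring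
    have h0 : (fun ω => Φ (X 0 ω, X 1 ω)) =ᵐ[P]
        fun ω => Φ (F fun i => ξ i ω, F (seqShift 1 fun i => ξ i ω)) := by
      filter_upwards [hXF 0, hXF 1] with ω h0 h1
      rw [h0, h1, seqShift_zero]
    rw [integral_congr_ae h0]
    filter_upwards [hN.ae_tendsto_average hG (hint.congr h0), ae_all_iff.2 hXF] with ω h1 h2
    refine h1.congr fun n => ?_
    simp only [h2, hcomp]
  have hC : ∫ ω, X 1 ω ^ 2 ∂P = ∫ ω, X 0 ω ^ 2 ∂P :=
    ((hX.identDistrib 1).comp (measurable_id.pow_const 2)).integral_eq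
  have hX1 : MemLp (X 1) 2 P := hX2 1
  have hA := key (fun p => p.1 ^ 2) (by fun_prop) (hX2 0).integrable_sq
  have hB := key (fun p => p.1 * p.2) (by fun_prop) ((hX2 0).integrable_mul hX1)
  have hC' := key (fun p => p.2 ^ 2) (by fun_prop) hX1.integrable_sq
  rw [hC] at hC'
  filter_upwards [hA, hB, hC'] with ω h1 h2 h3
  exact tendsto_sigmaHat hu h1 h2 h3

/-- The second-order structure of the solution. -/
theorem second_order (hX : IsSolution P θ α ξ X) (hN : IsNoise P ξ s t₂ t₄)
    (hρ : spectralRadius ℂ ((matM θ α t₂ t₄).map (algebraMap ℝ ℂ)) < 1) (hs : 0 < s)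
    (ht : 0 < t₂) :
    2 * α * t₂ ≠ 1 ∧ 0 < ∫ ω, X 0 ω ^ 2 ∂P ∧
      (∫ ω, X 0 ω * X 1 ω ∂P) / ∫ ω, X 0 ω ^ 2 ∂P = thetaStar θ α t₂ ∧
      s < (1 - thetaStar θ α t₂ ^ 2) * ∫ ω, X 0 ω ^ 2 ∂P := by
  have hfix := hX.momentVec_fixed hN hρ
  have hr : ∫ ω, X 0 ω * X 1 ω ∂P = _ := (hX.isStep hN hρ 0).integral_mul_next (hN.pair _)
  -- Nonnegativity of `E[(qX₀ + αη₀X₀)²]`, used at `q = θ` for positive variance and at `q = θ - θ*`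
  -- for the strict inequality.
  have hquad := fun q =>
    (integral_nonneg (μ := P) fun ω => sq_nonneg _).trans_eq
      (integral_affine_mul_sq (q : ℝ) α (hX.memLp hN hρ 0).1 (hX.memLp hN hρ 0).2)
  have hu : ∫ ω, X 0 ω ^ 2 ∂P = momentVec P (fun ω => (ξ 0 ω).2) (X 0) 0 := rfl
  have hu0 : 0 ≤ ∫ ω, X 0 ω ^ 2 ∂P := integral_nonneg fun ω => sq_nonneg _
  rw [hu] at hu0 ⊢
  rw [hr]
  have e0 := congrFun hfix 0
  have e1 := congrFun hfix 1
  generalize momentVec P (fun ω => (ξ 0 ω).2) (X 0) = V at *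
  simp only [matM, Matrix.mulVec, dotProduct, Fin.sum_univ_three, Pi.add_apply,
    Matrix.of_apply, Matrix.cons_val] at e0 e1
  have hpos : 0 < V 0 := by nlinarith [hquad θ, mul_nonneg ht.le hu0]
  -- Otherwise the second row forces `θ = 0`, and then `(0, 1, 0)` is fixed by `M`, whose powers
  -- tend to zero.
  have hne : 2 * α * t₂ ≠ 1 := by
    intro h1
    have h2 : θ = 0 := by
      have h3 : 2 * θ * t₂ * V 0 = 0 := by rw [h1] at e1; linarith
      simpa [ht.ne', hpos.ne'] using h3
    subst h2
    have hev : matM 0 α t₂ t₄ *ᵥ ![0, 1, 0] = ![0, 1, 0] := by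
      funext i
      fin_cases i <;> simp [matM, Matrix.mulVec, dotProduct, Fin.sum_univ_three, h1]
    have hpow : ∀ n : ℕ, matM 0 α t₂ t₄ ^ n *ᵥ ![0, 1, 0] = ![0, 1, 0] := by
      intro n
      induction n with
      | zero => simp
      | succ n ih => rw [pow_succ, ← Matrix.mulVec_mulVec, hev, ih]
    have h3 := (Matrix.summable_norm_pow_mulVec hρ ![0, 1, 0]).tendsto_atTop_zero
    simp only [hpow] at h3
    have h4 := norm_eq_zero.1 (tendsto_nhds_unique tendsto_const_nhds h3)
    simpa using congrFun h4 1
  have hd : 1 - 2 * α * t₂ ≠ 0 := sub_ne_zero.2 hne.symm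
  have hstar : (θ * V 0 + α * V 1) / V 0 = thetaStar θ α t₂ := by
    rw [thetaStar, div_eq_div_iff hpos.ne' hd]
    linear_combination α * e1
  refine ⟨hne, hpos, hstar, ?_⟩
  -- Eliminating `V 2` by the first row and `V 1` by `hm` turns this into `s + t₂ * V 0 ≤ (1 - θ*²)
  -- * V 0`.
  have hq := hquad (θ - thetaStar θ α t₂)
  have hm : θ * V 0 + α * V 1 = thetaStar θ α t₂ * V 0 := by
    rw [← hstar, div_mul_cancel₀ _ hpos.ne']
  have hm' := congrArg (thetaStar θ α t₂ * ·) hm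
  have : 0 < t₂ * V 0 := mul_pos ht hpos
  linarith

end IsSolution

end RCAR

/-! ### From the hypotheses to the noise model, and the conclusion. -/

theorem RCAR.isNoise {Ω : Type*} [MeasurableSpace Ω] {P : Measure Ω} [IsProbabilityMeasure P]
    {θ α : ℝ} {ε η : ℤ → Ω → ℝ} (h1 : RCAR.H1 P θ α ε η) (h2 : RCAR.H2 P ε η)
    (h3 : RCAR.H3 P θ α ε η) :
    RCAR.IsNoise P (fun t ω => (ε t ω, η t ω)) (RCAR.moment0 P ε 2) (RCAR.moment0 P η 2)
      (RCAR.moment0 P η 4) := by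
  have hindep : ∀ t, IndepFun (ε t) (η t) P := fun t =>
    h1.indep.comp (measurable_pi_apply t) (measurable_pi_apply t)
  have hidε : ∀ t (n : ℕ), IdentDistrib (fun ω => ε t ω ^ n) (fun ω => ε 0 ω ^ n) P P :=
    fun t n => (h1.noise_ε.identDistrib t).comp (measurable_id.pow_const n)
  have hidη : ∀ t (n : ℕ), IdentDistrib (fun ω => η t ω ^ n) (fun ω => η 0 ω ^ n) P P :=
    fun t n => (h1.noise_η.identDistrib t).comp (measurable_id.pow_const n)
  have hε := h1.noise_ε.measurable
  have hη := h1.noise_η.measurable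
  refine ⟨fun t => ?_, h1.noise_ε.indep.prodMk_of_indepFun hε hη h1.noise_η.indep h1.indep,
    fun t => ?_⟩
  · exact
      { measurable_left := hε t
        measurable_right := hη t
        indep := (hindep t).symm
        integrable_left := (hidε t 2).integrable_iff.2 h3.σ₂_finite
        integrable_right := (hidη t 4).integrable_iff.2 h3.τ₄_finite
        -- Finite higher even moments guarantee that the first and third moments needed here exist,
        -- hence vanish.
        left_one := (hidε t 1).integral_eq.trans
          (h2.odd_ε 0 (integrable_pow_of_le (hε 0) (by lia) h3.σ₂_finite))
        left_two := (hidε t 2).integral_eq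
        right_one := (hidη t 1).integral_eq.trans
          (h2.odd_η 0 (integrable_pow_of_le (hη 0) (by lia) h3.τ₄_finite))
        right_two := (hidη t 2).integral_eq
        right_three := (hidη t 3).integral_eq.trans
          (h2.odd_η 1 (integrable_pow_of_le (hη 0) (by lia) h3.τ₄_finite))
        right_four := (hidη t 4).integral_eq }
  · rw [(indepFun_iff_map_prod_eq_prod_map_map (hε t).aemeasurable (hη t).aemeasurable).1
        (hindep t),
      (indepFun_iff_map_prod_eq_prod_map_map (hε 0).aemeasurable (hη 0).aemeasurable).1
        (hindep 0), (h1.noise_ε.identDistrib t).map_eq, (h1.noise_η.identDistrib t).map_eq]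

theorem RCAR.IsStationarySolution.isSolution {Ω : Type*} [MeasurableSpace Ω] {P : Measure Ω}
    {θ α : ℝ} {ε η X : ℤ → Ω → ℝ} (hX : RCAR.IsStationarySolution P θ α ε η X) :
    RCAR.IsSolution P θ α (fun t ω => (ε t ω, η t ω)) X := by
  refine ⟨hX.measurable, hX.recurrence, fun t =>
    ⟨(hX.measurable t).aemeasurable, (hX.measurable 0).aemeasurable, ?_⟩⟩
  have h := congrArg (Measure.map fun y : ℤ → ℝ => y 0) (hX.stationary t)
  rw [Measure.map_map (measurable_pi_apply 0)
      (measurable_pi_lambda _ fun i => hX.measurable (i + t)),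
    Measure.map_map (measurable_pi_apply 0) (measurable_pi_lambda _ hX.measurable)] at h
  simpa [Function.comp_def] using h

theorem mainTheorem7 {Ω : Type*} [MeasurableSpace Ω] (P : Measure Ω) [IsProbabilityMeasure P]
    (θ α : ℝ) (ε η X : ℤ → Ω → ℝ)
    (h1 : RCAR.H1 P θ α ε η) (h2 : RCAR.H2 P ε η) (h3 : RCAR.H3 P θ α ε η)
    (hX : RCAR.IsStationarySolution P θ α ε η X) :
    -- the limit is well defined
    2 * α * RCAR.moment0 P η 2 ≠ 1 ∧ MemLp (X 0) 2 P ∧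
    -- almost sure convergence
    (∀ᵐ ω ∂P, Tendsto (fun n : ℕ => RCAR.sigmaHat X n ω) atTop
      (𝓝 (RCAR.sigmaStar P θ α η X))) ∧
    -- the estimator is not consistent for the variance of the noise, not even in probability
    ¬ TendstoInMeasure P (fun n : ℕ => RCAR.sigmaHat X n) atTop
      (fun _ => RCAR.moment0 P ε 2) := by
  have hN := RCAR.isNoise h1 h2 h3
  have hS := hX.isSolution
  have hρ := h3.spectralRadius_lt
  obtain ⟨hne, hpos, hstar, hlt⟩ := hS.second_order hN hρ h3.σ₂_pos h3.τ₂_pos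
  have hcov : RCAR.autocov P X 0 = ∫ ω, X 0 ω ^ 2 ∂P := by
    rw [RCAR.autocov, covariance_self (hX.measurable 0).aemeasurable,
      variance_of_integral_eq_zero (hX.measurable 0).aemeasurable (hS.integral_eq_zero hN hρ)]
  have hlim := hS.ae_tendsto_sigmaHat hN hρ hpos.ne'
  rw [hstar, ← hcov] at hlim
  rw [← hcov] at hlt
  refine ⟨hne, (hS.memLp hN hρ 0).1, hlim, fun hconv => ?_⟩
  -- Convergence in probability gives an a.s. convergent subsequence, whose limit would have to be
  -- both `σ₂` and the strictly larger `σ₂*`.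
  obtain ⟨ns, hns, hns'⟩ := hconv.exists_seq_tendsto_ae
  obtain ⟨ω, hω1, hω2⟩ := (hlim.and hns').exists
  exact hlt.ne (tendsto_nhds_unique hω2 (hω1.comp hns.tendsto_atTop))
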